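/- Let $\mathcal D\subset\mathbb R$ be measurable, let $\|\cdot\|$ and $\langle\cdot,\cdot\rangle$ be the norm and scalar product of $\mathbb L_2(\mathcal D)$, and let $(W_u)_{u\in\mathbb L_2(\mathcal D)}$ be a centered Gaussian process with $\mathbb E[W_uW_v]=\langle u,v\rangle$. For $s\in\mathbb L_2(\mathcal D)$ and $n\in\mathbb N^*=\{1,2,\dots\}$ one observes $Y_n(u)=\langle u,s\rangle+n^{-1/2}W_u$, $u\in\mathbb L_2(\mathcal D)$ (Gaussian white noise model). Let $\Phi=(\varphi_i)_{i\in\mathcal I}$ be a countable family in $\mathbb L_2(\mathcal D)$ and, for every $n\in\mathbb N^*$, let $\mathcal M_n$ be a non-empty set of models, a model being the linear span $m$ of finitely many of the $\varphi_i$; $D_m$ is its dimension and $s_m$ the orthogonal projection of $s$ onto $m$. For an orthonormal basis $(e^m_i)_{i\le D_m}$ of $m$ put $\hat s_m=\sum_i Y_n(e^m_i)e^m_i$, the minimizer over $u\in m$ of $\gamma_n(u)=-2Y_n(u)+\|u\|^2$, so that $\gamma_n(\hat s_m)=-\sum_iY_n(e_i^m)^2$. For a sequence $(\lambda_n)_{n\ge1}$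 of positive numbers let $$\hat m=\hat m(n)\in\arg\min_{m\in\mathcal M_n}\Big\{\gamma_n(\hat s_m)+\frac{\lambda_n}{n}D_m\Big\},\qquad Q(s,n)=\inf_{m\in\mathcal M_n}\Big\{\|s_m-s\|^2+\frac{\lambda_n}{n}D_m\Big\},\qquad \rho_{n,\alpha}=\Big(\frac{\lambda_n}{n}\Big)^{\frac{\alpha}{1+2\alpha}} .$$ Let $0<\alpha_0<\infty$. Assume that $\mathcal M_n\subset\mathcal M_{n+1}$ for every $n$, that $(\lambda_n)_n$ is non-decreasing with $\lim_n n^{-1}\lambda_n=0$, and that there are $n_0\in\mathbb N^*$, $0<\delta\le\frac12$, $0<p<1$ and $\kappa>1$ such that * $\lambda_{2n}\le 2(1-\delta)\lambda_n$ for every $n\ge n_0$; * $\lambda_{n_0}\ge\Upsilon(\delta,p,\alpha_0):=\dfrac{8}{p\,g}\Big(\dfrac{16}{g}+1\Big)$, where $g=(1-\delta)^{\frac{2\alpha_0}{2\alpha_0+1}}-(1-\delta)$; * $\sum_{m\in\mathcal M_n}\exp\big(-\tfrac12(\sqrt{\kappa^{-1}\lambda_n}-1)^2D_m\big)\le\sqrt{1-p}$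 for every $n\ge1$; * $\lambda_n\ge\kappa$ for every $n<n_0$ (an empty condition if $n_0=1$). Then, for every $n\ge1$ and every $s\in\mathbb L_2(\mathcal D)$, the penalized criterion almost surely has a minimizer $\hat m$ over $\mathcal M_n$; and for every $\alpha\in(0,\alpha_0]$ and every such choice of $\hat m$, $$MS(\hat s_{\hat m},\rho_\alpha):=\Big\{s\in\mathbb L_2(\mathcal D):\ \sup_{n\ge1}\rho_{n,\alpha}^{-2}\,\mathbb E\|\hat s_{\hat m}-s\|^2<\infty\Big\}=\Big\{s\in\mathbb L_2(\mathcal D):\ \sup_{n\ge1}\rho_{n,\alpha}^{-2}\,Q(s,n)<\infty\Big\},$$ with equivalence of balls: for every $R>0$ there is $R'>0$, not depending on $s$, such that $\sup_n\rho_{n,\alpha}^{-2}\mathbb E\|\hat s_{\hat m}-s\|^2\le R^2$ implies $\sup_n\rho_{n,\alpha}^{-2}Q(s,n)\le (R')^2$; and for every $R'>0$ there is $R>0$, not depending on $s$, such that the second bound implies the first. -/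

import Mathlib

open MeasureTheory ProbabilityTheory
open scoped ENNReal

noncomputable section

namespace WhiteNoise

/-- The Hilbert space `L₂(D)` of square integrable real functions on `D ⊂ ℝ` (Lebesgue measure). -/
abbrev L2 (D : Set ℝ) : Type := Lp ℝ 2 (volume.restrict D)

/-- The noise `u ↦ W_u = ∫_D u dW`: a centered Gaussian process indexed by `L₂(D)` with
covariance `E[W_u W_v] = ∫_D u v`. -/
structure IsWhiteNoise {D : Set ℝ} {Ω : Type*} [MeasurableSpace Ω]
    (W : L2 D → Ω → ℝ) (P : Measure Ω) : Prop where
  gaussian : IsGaussianProcess W P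
  centered : ∀ u, ∫ ω, W u ω ∂P = 0
  covariance : ∀ u v, ∫ ω, W u ω * W v ω ∂P = inner ℝ u v

/-- The observation `Y_n(u) = ∫_D u s + n^{-1/2} W_u`. -/
def obs {D : Set ℝ} {Ω : Type*} (W : L2 D → Ω → ℝ) (n : ℕ) (s u : L2 D) (ω : Ω) : ℝ :=
  inner ℝ u s + (1 / √(n : ℝ)) * W u ω

/-- A model built on the dictionary `φ`: the linear span of finitely many of its elements. -/
abbrev Model {D : Set ℝ} {ι : Type*} (φ : ι → L2 D) : Type :=
  {m : Submodule ℝ (L2 D) // ∃ J : Finset ι, m = Submodule.span ℝ (φ '' (J : Set ι))}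

instance Model.instFiniteDimensional {D : Set ℝ} {ι : Type*} {φ : ι → L2 D} (m : Model φ) :
    FiniteDimensional ℝ m.1 := by
  obtain ⟨m, J, rfl⟩ := m
  exact FiniteDimensional.span_of_finite ℝ (J.finite_toSet.image φ)

section Procedure

variable {D : Set ℝ} {ι : Type*} {φ : ι → L2 D} {Ω : Type*}

/-- The dimension `D_m`. -/
def Model.dim (m : Model φ) : ℕ := Module.finrank ℝ m.1

/-- An orthonormal basis `e^m_1, …, e^m_{D_m}` of `m`. -/
def Model.basis (m : Model φ) : OrthonormalBasis (Fin m.dim) ℝ m.1 :=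
  stdOrthonormalBasis ℝ m.1

/-- The orthogonal projection `s_m` of `s` onto `m`. -/
def Model.proj (m : Model φ) (s : L2 D) : L2 D := m.1.starProjection s

/-- The empirical coefficient `Y_n(e^m_i)`. -/
def coeffHat (W : L2 D → Ω → ℝ) (n : ℕ) (s : L2 D) (m : Model φ) (i : Fin m.dim) (ω : Ω) : ℝ :=
  obs W n s (m.basis i : L2 D) ω

/-- The projection estimator `ŝ_m = ∑ i, Y_n(e^m_i) e^m_i`. -/
def sHat (W : L2 D → Ω → ℝ) (n : ℕ) (s : L2 D) (m : Model φ) (ω : Ω) : L2 D :=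
  ∑ i, coeffHat W n s m i ω • (m.basis i : L2 D)

/-- The value `γ_n(ŝ_m) = -∑ i, Y_n(e^m_i)²` of the empirical contrast
`γ_n(u) = -2 Y_n(u) + ‖u‖²` at its minimizer over `m`. -/
def contrastHat (W : L2 D → Ω → ℝ) (n : ℕ) (s : L2 D) (m : Model φ) (ω : Ω) : ℝ :=
  -∑ i, coeffHat W n s m i ω ^ 2

/-- The penalty `pen_n(m) = (lam_n / n) D_m`. -/
def pen (lam : ℕ → ℝ) (n : ℕ) (m : Model φ) : ℝ := lam n / n * m.dim

/-- `m` minimizes `γ_n(ŝ_m) + pen_n(m)` over the collection `M_n`, for the outcome `ω`. -/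
def IsPenMinimizer (W : L2 D → Ω → ℝ) (M : ℕ → Set (Model φ)) (lam : ℕ → ℝ)
    (n : ℕ) (s : L2 D) (ω : Ω) (m : Model φ) : Prop :=
  m ∈ M n ∧ ∀ m' ∈ M n,
    contrastHat W n s m ω + pen lam n m ≤ contrastHat W n s m' ω + pen lam n m'

/-- `mHat` is a penalized selection rule: for every `n ≥ 1` and every signal `s`, the selected
model `mHat n s ω` almost surely minimizes the penalized criterion over `M_n`. -/
def IsPenSelection [MeasurableSpace Ω] (P : Measure Ω) (W : L2 D → Ω → ℝ)
    (M : ℕ → Set (Model φ)) (lam : ℕ → ℝ) (mHat : ℕ → L2 D → Ω → Model φ) : Prop :=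
  ∀ n, 1 ≤ n → ∀ s, ∀ᵐ ω ∂P, IsPenMinimizer W M lam n s ω (mHat n s ω)

/-- The quadratic risk `E ‖ŝ_m̂ - s‖²`, possibly infinite. -/
def risk [MeasurableSpace Ω] (P : Measure Ω) (W : L2 D → Ω → ℝ)
    (mHat : ℕ → L2 D → Ω → Model φ) (n : ℕ) (s : L2 D) : ℝ≥0∞ :=
  ∫⁻ ω, ENNReal.ofReal (‖sHat W n s (mHat n s ω) ω - s‖ ^ 2) ∂P

/-- The rate `ρ_{n,α} = (lam_n / n)^(α / (1 + 2 α))`. -/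
def rate (lam : ℕ → ℝ) (α : ℝ) (n : ℕ) : ℝ := (lam n / n) ^ (α / (1 + 2 * α))

/-- `sup_{n ≥ 1} ρ_n⁻² a_n`, in `[0, ∞]`. -/
def supRate (ρ : ℕ → ℝ) (a : ℕ → ℝ≥0∞) : ℝ≥0∞ :=
  ⨆ (n : ℕ) (_ : 1 ≤ n), ENNReal.ofReal ((ρ n ^ 2)⁻¹) * a n

/-- The maxiset `MS(ŝ_m̂, ρ)`. -/
def maxiset [MeasurableSpace Ω] (P : Measure Ω) (W : L2 D → Ω → ℝ)
    (mHat : ℕ → L2 D → Ω → Model φ) (ρ : ℕ → ℝ) : Set (L2 D) :=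
  {s | supRate ρ (fun n => risk P W mHat n s) < ∞}

/-- The ball `MS(ŝ_m̂, ρ)(R)` of radius `R` of the maxiset. -/
def maxisetBall [MeasurableSpace Ω] (P : Measure Ω) (W : L2 D → Ω → ℝ)
    (mHat : ℕ → L2 D → Ω → Model φ) (ρ : ℕ → ℝ) (R : ℝ) : Set (L2 D) :=
  {s | supRate ρ (fun n => risk P W mHat n s) ≤ ENNReal.ofReal (R ^ 2)}

/-- `Q(s,n) = inf_{m ∈ M_n} (‖s_m - s‖² + (lam_n / n) D_m)`. -/
def Q (M : ℕ → Set (Model φ)) (lam : ℕ → ℝ) (s : L2 D) (n : ℕ) : ℝ :=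
  ⨅ m : M n, (‖m.1.proj s - s‖ ^ 2 + lam n / n * m.1.dim)

/-- The approximation set of all `s` with `sup_n ρ_n⁻² Q(s,n) < ∞`. -/
def approxSet (M : ℕ → Set (Model φ)) (lam : ℕ → ℝ) (ρ : ℕ → ℝ) : Set (L2 D) :=
  {s | supRate ρ (fun n => ENNReal.ofReal (Q M lam s n)) < ∞}

/-- The ball of radius `R` of the approximation set: `sup_n ρ_n⁻² Q(s,n) ≤ R²`. -/
def approxBall (M : ℕ → Set (Model φ)) (lam : ℕ → ℝ) (ρ : ℕ → ℝ) (R : ℝ) : Set (L2 D) :=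
  {s | supRate ρ (fun n => ENNReal.ofReal (Q M lam s n)) ≤ ENNReal.ofReal (R ^ 2)}

end Procedure

/-- `g(δ, α₀) = (1 - δ)^(2 α₀ / (2 α₀ + 1)) - (1 - δ)`. -/
def gConst (δ α₀ : ℝ) : ℝ := (1 - δ) ^ (2 * α₀ / (2 * α₀ + 1)) - (1 - δ)

/-- `Υ(δ, p, α₀) = 8 / (p g) * (16 / g + 1)` with `g = g(δ, α₀)`. -/
def Upsilon (δ p α₀ : ℝ) : ℝ := 8 / (p * gConst δ α₀) * (16 / gConst δ α₀ + 1)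

end WhiteNoise

end

namespace WhiteNoise

/-! The theorem reduces (`maxiset_eq_and_balls`) to comparing the risk with `Q` from both sides.

Upper side, `IsWhiteNoise.risk_le`: an oracle inequality, risk ≤ C `Q`. By the Kraft-type sum and
Gaussian concentration, the total excess of the squared noise norms over thresholds proportional to
`D_m + 1` has bounded expectation. The penalty of the selected model then absorbs its noise, which
is where `κ > 1` provides room. The same excess, being almost surely finite, makes the criterion
coercive in the dimension, hence a minimizer exists.

Lower side, `IsWhiteNoise.exists_Q_le_mul_rate_sq`: the risk does not dominate `Q` with a constant
uniform in `n`, so the behaviour along doublings is used. Let `Q_a` be `Q` with penalty weight `a *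
lam`, for a small fixed `a`, and let `m` attain `Q_a(s,n)`. With positive probability all noise
norms are moderate, and then the bias of `m` is at most three times the loss plus `g/4` times its
penalty (`IsWhiteNoise.ofReal_bias_sub_le_risk`). Reusing `m` at `2n` keeps the bias and multiplies
the penalty by `t = lam(2n) / (2 lam n)`, so that `Q_a(s,2n) ≤ (t + g/4) Q_a(s,n) + C risk`. The
squared rate is multiplied by `t^(2α/(1+2α)) ≥ t + g`, so an induction on dyadic multiples of `n₀`
closes (`le_mul_rate_sq_of_doubling`). Other `n ≥ n₀` follow by comparison with the dyadic point
below. The start `n₀` and the finitely many `n < n₀` use a cruder bound with a constant depending on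
`n`. -/

/-- A centered Gaussian process indexed by a Hilbert space, with covariance the scalar product. -/
structure IsIsonormal {H : Type*} [NormedAddCommGroup H] [InnerProductSpace ℝ H]
    {Ω : Type*} [MeasurableSpace Ω] (W : H → Ω → ℝ) (P : Measure Ω) : Prop where
  gaussian : IsGaussianProcess W P
  centered : ∀ u, ∫ ω, W u ω ∂P = 0
  covariance : ∀ u v, ∫ ω, W u ω * W v ω ∂P = inner ℝ u v

/-- The projection of the noise `W` onto a finite dimensional subspace `E`. -/
noncomputable def noiseVec {H : Type*} [NormedAddCommGroup H] [InnerProductSpace ℝ H]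
    {Ω : Type*} (W : H → Ω → ℝ) (E : Submodule ℝ H) [FiniteDimensional ℝ E] (ω : Ω) : H :=
  ∑ j, W (stdOrthonormalBasis ℝ E j : H) ω • (stdOrthonormalBasis ℝ E j : H)

/-! ### Noise projected onto finite dimensional subspaces, and its chi-square law. -/

section NoiseVec

variable {H : Type*} [NormedAddCommGroup H] [InnerProductSpace ℝ H]
  {Ω : Type*} {W : H → Ω → ℝ}

theorem inner_noiseVec (E : Submodule ℝ H) [FiniteDimensional ℝ E] (u : H) (ω : Ω) :
    inner ℝ u (noiseVec W E ω) = ∑ j, inner ℝ u (stdOrthonormalBasis ℝ E j : H) *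
      W (stdOrthonormalBasis ℝ E j : H) ω := by
  simp only [noiseVec, inner_sum, real_inner_smul_right]
  exact Finset.sum_congr rfl fun j _ => mul_comm _ _

theorem norm_noiseVec_sq (E : Submodule ℝ H) [FiniteDimensional ℝ E] (ω : Ω) :
    ‖noiseVec W E ω‖ ^ 2 = ∑ j, W (stdOrthonormalBasis ℝ E j : H) ω ^ 2 := by
  have ho : Orthonormal ℝ fun j => (stdOrthonormalBasis ℝ E j : H) :=
    (stdOrthonormalBasis ℝ E).orthonormal.comp_linearIsometry E.subtypeₗᵢ
  rw [← real_inner_self_eq_norm_sq, noiseVec, ho.inner_sum]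
  exact Finset.sum_congr rfl fun j _ => by simp [sq]

end NoiseVec

section Isonormal

variable {H : Type*} [NormedAddCommGroup H] [InnerProductSpace ℝ H]
  {Ω : Type*} [MeasurableSpace Ω] {W : H → Ω → ℝ} {P : Measure Ω}

theorem IsIsonormal.memLp_two (hW : IsIsonormal W P) (u : H) : MemLp (W u) 2 P :=
  (hW.gaussian.hasGaussianLaw_eval u).memLp_two

theorem IsIsonormal.integrable_mul (hW : IsIsonormal W P) (u v : H) :
    Integrable (fun ω => W u ω * W v ω) P :=
  (hW.memLp_two u).integrable_mul (hW.memLp_two v)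

theorem IsIsonormal.integral_sum_sq (hW : IsIsonormal W P) {σ : Type*} (I : Finset σ)
    (c : σ → ℝ) (v : σ → H) :
    ∫ ω, (∑ j ∈ I, c j * W (v j) ω) ^ 2 ∂P = ‖∑ j ∈ I, c j • v j‖ ^ 2 := by
  have h1 : ∀ ω, (∑ j ∈ I, c j * W (v j) ω) ^ 2
      = ∑ i ∈ I, ∑ j ∈ I, c i * c j * (W (v i) ω * W (v j) ω) := fun ω => by
    rw [sq, Finset.sum_mul_sum]
    exact Finset.sum_congr rfl fun i _ => Finset.sum_congr rfl fun j _ => by ring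
  simp_rw [h1]
  rw [integral_finsetSum _ fun i _ => integrable_finsetSum _ fun j _ =>
    (hW.integrable_mul _ _).const_mul _, ← real_inner_self_eq_norm_sq, sum_inner]
  refine Finset.sum_congr rfl fun i _ => ?_
  rw [integral_finsetSum _ fun j _ => (hW.integrable_mul _ _).const_mul _, inner_sum]
  refine Finset.sum_congr rfl fun j _ => ?_
  rw [integral_const_mul, hW.covariance, real_inner_smul_left, real_inner_smul_right]
  ring

/-- `W` is linear only almost surely: the covariance makes the second moment of a combination of
noises the squared norm of the same combination of vectors. -/
theorem IsIsonormal.sum_ae_eq_zero (hW : IsIsonormal W P) {σ : Type*} (I : Finset σ)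
    (c : σ → ℝ) (v : σ → H) (h : ∑ j ∈ I, c j • v j = 0) :
    ∀ᵐ ω ∂P, ∑ j ∈ I, c j * W (v j) ω = 0 := by
  have h0 := hW.integral_sum_sq I c v
  rw [h, norm_zero, zero_pow two_ne_zero] at h0
  have hL : MemLp (fun ω => ∑ j ∈ I, c j * W (v j) ω) 2 P :=
    memLp_finsetSum I fun j _ => (hW.memLp_two (v j)).const_mul (c j)
  have hint : Integrable (fun ω => (∑ j ∈ I, c j * W (v j) ω) ^ 2) P := hL.integrable_sq
  filter_upwards [(integral_eq_zero_iff_of_nonneg (fun ω => sq_nonneg _) hint).1 h0] with ω hω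
  exact pow_eq_zero_iff two_ne_zero |>.1 hω

theorem IsIsonormal.inner_noiseVec_ae (hW : IsIsonormal W P) (E : Submodule ℝ H)
    [FiniteDimensional ℝ E] {u : H} (hu : u ∈ E) :
    ∀ᵐ ω ∂P, inner ℝ u (noiseVec W E ω) = W u ω := by
  set b := stdOrthonormalBasis ℝ E with hb
  have hsum : ∑ j, inner ℝ u (b j : H) • (b j : H) = u := by
    have := congrArg (fun x : E => (x : H)) (b.sum_repr' ⟨u, hu⟩)
    simp only [Submodule.coe_sum, Submodule.coe_smul, Submodule.coe_inner] at this
    rw [← this]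
    refine Finset.sum_congr rfl fun j _ => ?_
    rw [this, real_inner_comm]
  -- The linear relation used is the expansion of `u` in the basis minus `u`; the index `none`
  -- carries `u`.
  have h := hW.sum_ae_eq_zero (σ := Option (Fin (Module.finrank ℝ E))) Finset.univ
    (fun o => o.elim (-1) fun j => inner ℝ u (b j : H)) (fun o => o.elim u fun j => (b j : H))
    (by simp [Fintype.sum_option, hsum])
  filter_upwards [h] with ω hω
  rw [inner_noiseVec]
  simp only [Fintype.sum_option, Option.elim] at hω
  linarith

theorem lintegral_exp_mul_sq_gaussianReal {t : ℝ} (ht : t < 1 / 2) :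
    ∫⁻ x, ENNReal.ofReal (Real.exp (t * x ^ 2)) ∂(gaussianReal 0 1)
      = ENNReal.ofReal ((1 - 2 * t) ^ (-(1 / 2) : ℝ)) := by
  have hpos : 0 < 1 - 2 * t := by linarith
  rw [gaussianReal_of_var_ne_zero _ one_ne_zero,
    lintegral_withDensity_eq_lintegral_mul _ (measurable_gaussianPDF 0 1) (by fun_prop)]
  have h1 : ∀ x : ℝ, (gaussianPDF 0 1 * fun x => ENNReal.ofReal (Real.exp (t * x ^ 2))) x
      = ENNReal.ofReal ((√(2 * Real.pi))⁻¹ * Real.exp (-(1 / 2 - t) * x ^ 2)) := fun x => by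
    rw [Pi.mul_apply, gaussianPDF, ← ENNReal.ofReal_mul (gaussianPDFReal_nonneg _ _ _),
      gaussianPDFReal]
    congr 1
    rw [mul_assoc, ← Real.exp_add]
    simp only [NNReal.coe_one, mul_one, sub_zero]
    congr 2
    ring
  simp_rw [h1]
  have hb : 0 < 1 / 2 - t := by linarith
  rw [← ofReal_integral_eq_lintegral_ofReal ((integrable_exp_neg_mul_sq hb).const_mul _)
    (.of_forall fun x => by positivity), integral_const_mul, integral_gaussian]
  congr 1
  rw [Real.rpow_neg hpos.le, ← Real.sqrt_eq_rpow, ← Real.sqrt_inv, ← Real.sqrt_inv,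
    ← Real.sqrt_mul (by positivity)]
  congr 1
  have : Real.pi ≠ 0 := Real.pi_ne_zero
  field_simp

theorem IsIsonormal.map_eq_gaussianReal (hW : IsIsonormal W P) {u : H} (hu : ‖u‖ = 1) :
    P.map (W u) = gaussianReal 0 1 := by
  have := hW.gaussian.isProbabilityMeasure
  rw [(hW.gaussian.hasGaussianLaw_eval u).map_eq_gaussianReal, hW.centered,
    variance_of_integral_eq_zero (hW.gaussian.aemeasurable u) (hW.centered u)]
  congr 1
  have := hW.covariance u u
  simp only [← sq, real_inner_self_eq_norm_sq, hu, one_pow] at this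
  rw [this, Real.toNNReal_one]

theorem IsIsonormal.iIndepFun (hW : IsIsonormal W P) {σ : Type*} {v : σ → H}
    (hv : Orthonormal ℝ v) : iIndepFun (fun i => W (v i)) P := by
  have := hW.gaussian.isProbabilityMeasure
  have h := IsGaussianProcess.iIndepFun_of_covariance_eq_zero (T := σ) (S := fun _ => Unit)
    (X := fun i _ => W (v i)) (hW.gaussian.comp_right fun q : (_ : σ) × Unit => v q.1)
    (fun i _ => hW.gaussian.aemeasurable _) (fun i j hij _ _ => by
      rw [covariance_eq_sub (hW.memLp_two _) (hW.memLp_two _)]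
      simp only [Pi.mul_apply, hW.covariance, hW.centered, hv.2 hij, mul_zero, sub_zero])
  exact h.comp (fun _ (x : Unit → ℝ) => x ()) fun _ => measurable_pi_apply ()

theorem IsIsonormal.lintegral_exp_mul_norm_noiseVec_sq (hW : IsIsonormal W P)
    (E : Submodule ℝ H) [FiniteDimensional ℝ E] {t : ℝ} (ht : t < 1 / 2) :
    ∫⁻ ω, ENNReal.ofReal (Real.exp (t * ‖noiseVec W E ω‖ ^ 2)) ∂P
      = ENNReal.ofReal ((1 - 2 * t) ^ (-(Module.finrank ℝ E / 2) : ℝ)) := by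
  have hpos : 0 < 1 - 2 * t := by linarith
  set b := stdOrthonormalBasis ℝ E
  have ho : Orthonormal ℝ fun j => (b j : H) := b.orthonormal.comp_linearIsometry E.subtypeₗᵢ
  have hm := fun j => hW.gaussian.aemeasurable (b j : H)
  -- The coordinates are only a.e. measurable, so the product formula is applied to measurable
  -- versions.
  have hind := (hW.iIndepFun ho).congr fun j => (hm j).ae_eq_mk
  have hae : ∀ᵐ ω ∂P, ENNReal.ofReal (Real.exp (t * ‖noiseVec W E ω‖ ^ 2))
      = ∏ j, ENNReal.ofReal (Real.exp (t * (hm j).mk _ ω ^ 2)) := by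
    filter_upwards [ae_all_iff.2 fun j => (hm j).ae_eq_mk] with ω hω
    rw [norm_noiseVec_sq, Finset.mul_sum, Real.exp_sum,
      ENNReal.ofReal_prod_of_nonneg fun _ _ => (Real.exp_pos _).le]
    exact Finset.prod_congr rfl fun j _ => by rw [← hω j]
  have hg : Measurable fun x : ℝ => ENNReal.ofReal (Real.exp (t * x ^ 2)) := by fun_prop
  rw [lintegral_congr_ae hae, lintegral_prod_eq_prod_lintegral_of_indepFun _
    (fun j ω => ENNReal.ofReal (Real.exp (t * (hm j).mk _ ω ^ 2))) (hind.comp _ fun _ => hg)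
    fun j => hg.comp (hm j).measurable_mk]
  have h1 : ∀ j, ∫⁻ ω, ENNReal.ofReal (Real.exp (t * (hm j).mk _ ω ^ 2)) ∂P
      = ENNReal.ofReal ((1 - 2 * t) ^ (-(1 / 2) : ℝ)) := fun j => by
    rw [← lintegral_exp_mul_sq_gaussianReal ht,
      ← hW.map_eq_gaussianReal (u := (b j : H)) (ho.1 j), lintegral_map' hg.aemeasurable (hm j)]
    exact lintegral_congr_ae ((hm j).ae_eq_mk.mono fun ω hω => by dsimp only; rw [hω])
  rw [Finset.prod_congr rfl fun j _ => h1 j, Finset.prod_const, Finset.card_univ,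
    Fintype.card_fin, ← ENNReal.ofReal_pow (by positivity), ← Real.rpow_mul_natCast hpos.le]
  congr 2
  ring

theorem IsIsonormal.aemeasurable_noiseVec_sq (hW : IsIsonormal W P)
    (E : Submodule ℝ H) [FiniteDimensional ℝ E] :
    AEMeasurable (fun ω => ‖noiseVec W E ω‖ ^ 2) P := by
  simp_rw [norm_noiseVec_sq]
  exact Finset.aemeasurable_fun_sum _ fun j _ => (hW.gaussian.aemeasurable _).pow_const 2

end Isonormal

theorem log_le_two_mul_sqrt_sub_one {v : ℝ} (hv : 0 < v) : Real.log v ≤ 2 * (√v - 1) := by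
  have h := Real.log_le_sub_one_of_pos (Real.sqrt_pos.2 hv)
  rw [Real.log_sqrt hv.le] at h
  linarith

/-! ### Chi-square deviations. -/

section Tails

variable {H : Type*} [NormedAddCommGroup H] [InnerProductSpace ℝ H]
  {Ω : Type*} [MeasurableSpace Ω] {W : H → Ω → ℝ} {P : Measure Ω}

/-- Chernoff bound in integrated form, from `x ≤ exp (μ x) / μ`. The choice `1 - 2μ = 1/v` gives the
exponent `k (log v - (v - 1)) / 2`, and `log v ≤ 2(√v - 1)` turns this into the square appearing in
the Kraft sum. -/
theorem IsIsonormal.lintegral_norm_noiseVec_sq_sub_le (hW : IsIsonormal W P)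
    (E : Submodule ℝ H) [FiniteDimensional ℝ E] {k : ℕ} (hk : Module.finrank ℝ E ≤ k)
    {v : ℝ} (hv : 1 < v) :
    ∫⁻ ω, ENNReal.ofReal (‖noiseVec W E ω‖ ^ 2 - k * v) ∂P
      ≤ ENNReal.ofReal (2 / (1 - 1 / v) * Real.exp (-((√v - 1) ^ 2 * k / 2))) := by
  have hv0 : 0 < v := by linarith
  have hv1 : 1 / v < 1 := by rw [div_lt_one hv0]; exact hv
  set μ : ℝ := (1 - 1 / v) / 2 with hμ
  have hμ0 : 0 < μ := by rw [hμ]; linarith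
  have hpos : (0 : ℝ) < 1 / v := by positivity
  have hpt : ∀ ω, ENNReal.ofReal (‖noiseVec W E ω‖ ^ 2 - k * v)
      ≤ ENNReal.ofReal (1 / μ * Real.exp (-(μ * (k * v))))
        * ENNReal.ofReal (Real.exp (μ * ‖noiseVec W E ω‖ ^ 2)) := fun ω => by
    rw [← ENNReal.ofReal_mul (by positivity)]
    refine ENNReal.ofReal_le_ofReal ?_
    rw [mul_assoc, ← Real.exp_add, div_mul_eq_mul_div, one_mul, le_div_iff₀ hμ0]
    have := Real.add_one_le_exp (-(μ * (k * v)) + μ * ‖noiseVec W E ω‖ ^ 2)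
    linarith
  refine (lintegral_mono hpt).trans ?_
  rw [lintegral_const_mul' _ _ ENNReal.ofReal_ne_top,
    hW.lintegral_exp_mul_norm_noiseVec_sq E (by rw [hμ]; linarith),
    ← ENNReal.ofReal_mul (by positivity)]
  refine ENNReal.ofReal_le_ofReal ?_
  have h2 : 1 - 2 * μ = v⁻¹ := by rw [hμ]; ring
  have hle : (v⁻¹) ^ (-(Module.finrank ℝ E / 2) : ℝ) ≤ Real.exp (Real.log v * (k / 2)) := by
    rw [Real.inv_rpow hv0.le, ← Real.rpow_neg hv0.le, neg_neg, ← Real.rpow_def_of_pos hv0]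
    have : (Module.finrank ℝ E : ℝ) ≤ k := by exact_mod_cast hk
    exact Real.rpow_le_rpow_of_exponent_le hv.le (by linarith)
  have hlog := log_le_two_mul_sqrt_sub_one hv0
  have hsq := Real.sq_sqrt hv0.le
  rw [h2]
  calc 1 / μ * Real.exp (-(μ * (k * v))) * (v⁻¹) ^ (-(Module.finrank ℝ E / 2) : ℝ)
      ≤ 1 / μ * Real.exp (-(μ * (k * v))) * Real.exp (Real.log v * (k / 2)) := by gcongr
    _ = 2 / (1 - 1 / v) * Real.exp (Real.log v * (k / 2) - (v - 1) * k / 2) := by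
        rw [mul_assoc, ← Real.exp_add]
        congr 1
        · rw [hμ, one_div_div]
        · congr 1
          have : μ * v = (v - 1) / 2 := by rw [hμ]; field_simp
          linear_combination (-(k : ℝ)) * this
    _ ≤ _ := by
        have : (0 : ℝ) < 2 / (1 - 1 / v) := by
          have : 0 < 1 - 1 / v := by linarith
          positivity
        gcongr
        have hk0 : (0 : ℝ) ≤ k := Nat.cast_nonneg k
        nlinarith [mul_nonneg hk0 (sub_nonneg.2 hlog)]

/-- Chernoff bound with parameter `1/4`: the Laplace transform is `2^(finrank/2) ≤ exp k` because `k
+ 1 ≤ 2k`, and `l ≥ 2` absorbs this factor. -/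
theorem IsIsonormal.measure_mul_le_norm_noiseVec_sq (hW : IsIsonormal W P)
    (E : Submodule ℝ H) [FiniteDimensional ℝ E] {k : ℕ} (hk : 1 ≤ k)
    (hE : Module.finrank ℝ E ≤ k + 1) {l : ℝ} (hl : 2 ≤ l) :
    P {ω | 4 * l * k ≤ ‖noiseVec W E ω‖ ^ 2} ≤ ENNReal.ofReal (Real.exp (-(l * k / 2))) := by
  have hk' : (1 : ℝ) ≤ k := by exact_mod_cast hk
  have hae : AEMeasurable (fun ω => ENNReal.ofReal (Real.exp (1 / 4 * ‖noiseVec W E ω‖ ^ 2))) P :=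
    ((hW.aemeasurable_noiseVec_sq E).const_mul _).exp.ennreal_ofReal
  have hsub : {ω | 4 * l * k ≤ ‖noiseVec W E ω‖ ^ 2}
      ⊆ {ω | ENNReal.ofReal (Real.exp (l * k))
        ≤ ENNReal.ofReal (Real.exp (1 / 4 * ‖noiseVec W E ω‖ ^ 2))} := fun ω hω => by
    refine ENNReal.ofReal_le_ofReal (Real.exp_le_exp.2 ?_)
    have : 4 * l * k ≤ ‖noiseVec W E ω‖ ^ 2 := hω
    linarith
  have h0 : ENNReal.ofReal (Real.exp (l * k)) ≠ 0 := by
    simpa using Real.exp_pos _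
  refine (measure_mono hsub).trans
    ((meas_ge_le_lintegral_div hae h0 ENNReal.ofReal_ne_top).trans ?_)
  rw [hW.lintegral_exp_mul_norm_noiseVec_sq E (by norm_num), ← ENNReal.ofReal_div_of_pos
    (Real.exp_pos _)]
  refine ENNReal.ofReal_le_ofReal ?_
  rw [div_le_iff₀ (Real.exp_pos _), ← Real.exp_add]
  have h2 : (1 - 2 * (1 / 4) : ℝ) = 2⁻¹ := by norm_num
  have hE' : (Module.finrank ℝ E : ℝ) ≤ k + 1 := by exact_mod_cast hE
  rw [h2, Real.inv_rpow (by norm_num), ← Real.rpow_neg (by norm_num), neg_neg,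
    Real.rpow_def_of_pos (by norm_num)]
  refine Real.exp_le_exp.2 ?_
  have hlog : Real.log 2 ≤ 1 := by linarith [Real.log_two_lt_d9]
  have hlog0 : 0 ≤ Real.log 2 := Real.log_nonneg (by norm_num)
  calc Real.log 2 * (Module.finrank ℝ E / 2) ≤ 1 * k := by
        gcongr
        linarith
    _ ≤ _ := by nlinarith

theorem IsIsonormal.measure_norm_noiseVec_sq_le (hW : IsIsonormal W P)
    (E : Submodule ℝ H) [FiniteDimensional ℝ E] {c : ℝ} (hc : 0 ≤ c) :
    P {ω | ‖noiseVec W E ω‖ ^ 2 ≤ Module.finrank ℝ E / (Real.exp (1 + c) - 1)}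
      ≤ ENNReal.ofReal (Real.exp (-(c * Module.finrank ℝ E / 2))) := by
  set d : ℝ := ((Module.finrank ℝ E : ℕ) : ℝ)
  -- With this `μ` the Laplace transform at `-μ` is `exp (-(1 + c) d / 2)`, while the threshold
  -- costs only `exp (d / 2)`.
  set μ : ℝ := (Real.exp (1 + c) - 1) / 2 with hμ
  have hμ0 : 0 < μ := by
    have := Real.add_one_le_exp (1 + c)
    rw [hμ]; linarith
  have hae : AEMeasurable (fun ω => ENNReal.ofReal (Real.exp (-μ * ‖noiseVec W E ω‖ ^ 2))) P :=
    ((hW.aemeasurable_noiseVec_sq E).const_mul _).exp.ennreal_ofReal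
  have hsub : {ω | ‖noiseVec W E ω‖ ^ 2 ≤ d / (Real.exp (1 + c) - 1)}
      ⊆ {ω | ENNReal.ofReal (Real.exp (-(d / 2)))
        ≤ ENNReal.ofReal (Real.exp (-μ * ‖noiseVec W E ω‖ ^ 2))} := fun ω hω => by
    refine ENNReal.ofReal_le_ofReal (Real.exp_le_exp.2 ?_)
    have h : ‖noiseVec W E ω‖ ^ 2 ≤ d / (Real.exp (1 + c) - 1) := hω
    rw [show Real.exp (1 + c) - 1 = 2 * μ by rw [hμ]; ring, le_div_iff₀ (by positivity)] at h
    linarith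
  have h0 : ENNReal.ofReal (Real.exp (-(d / 2))) ≠ 0 := by
    simpa using Real.exp_pos _
  refine (measure_mono hsub).trans
    ((meas_ge_le_lintegral_div hae h0 ENNReal.ofReal_ne_top).trans ?_)
  rw [hW.lintegral_exp_mul_norm_noiseVec_sq E (by linarith), ← ENNReal.ofReal_div_of_pos
    (Real.exp_pos _)]
  refine ENNReal.ofReal_le_ofReal ?_
  rw [div_le_iff₀ (Real.exp_pos _), ← Real.exp_add,
    show 1 - 2 * -μ = Real.exp (1 + c) by rw [hμ]; ring, ← Real.exp_mul]
  refine Real.exp_le_exp.2 (le_of_eq ?_)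
  ring

end Tails

/-! ### Hilbert space inequalities for projection estimators. -/

section Deterministic

variable {H : Type*} [NormedAddCommGroup H] [InnerProductSpace ℝ H]

theorem sum_inner_smul_eq_starProjection {m : Submodule ℝ H} [FiniteDimensional ℝ m] {σ : Type*}
    [Fintype σ] (e : OrthonormalBasis σ ℝ m) (y : H) :
    ∑ i, inner ℝ (e i : H) y • (e i : H) = m.starProjection y := by
  rw [Submodule.starProjection_apply, ← e.sum_repr' (m.orthogonalProjectionOnto y)]
  simp only [Submodule.coe_sum, Submodule.coe_smul]
  refine Finset.sum_congr rfl fun i _ => ?_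
  rw [Submodule.inner_orthogonalProjectionOnto_eq_of_mem_left]

theorem sum_inner_sq_eq_norm_starProjection_sq {m : Submodule ℝ H} [FiniteDimensional ℝ m]
    {σ : Type*} [Fintype σ] (e : OrthonormalBasis σ ℝ m) (y : H) :
    ∑ i, inner ℝ (e i : H) y ^ 2 = ‖m.starProjection y‖ ^ 2 := by
  rw [Submodule.starProjection_apply, ← Submodule.coe_norm,
    ← e.sum_sq_norm_inner_right (m.orthogonalProjectionOnto y)]
  refine Finset.sum_congr rfl fun i _ => ?_
  rw [← Submodule.inner_orthogonalProjectionOnto_eq_of_mem_left, Real.norm_eq_abs, sq_abs]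

theorem inner_starProjection_self (m : Submodule ℝ H) [m.HasOrthogonalProjection] (y : H) :
    inner ℝ (m.starProjection y) y = ‖m.starProjection y‖ ^ 2 := by
  have h := m.starProjection_inner_eq_zero y _ (m.starProjection_apply_mem y)
  rw [inner_sub_left, real_inner_self_eq_norm_sq, real_inner_comm] at h
  linarith

/-- The contrast on `m₂` is no larger at the estimator than at the projection of `s`. The noises may
differ between the two models, but their inner products with `s` agree and cancel, leaving noise
terms against the errors only. -/
theorem norm_sub_sq_add_le_of_contrast_le {m₁ m₂ : Submodule ℝ H} [m₁.HasOrthogonalProjection]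
    [m₂.HasOrthogonalProjection] {s N₁ N₂ : H} {p₁ p₂ : ℝ} (hN : inner ℝ s N₁ = inner ℝ s N₂)
    (h : -‖m₁.starProjection (s + N₁)‖ ^ 2 + p₁ ≤ -‖m₂.starProjection (s + N₂)‖ ^ 2 + p₂) :
    ‖m₁.starProjection (s + N₁) - s‖ ^ 2 + p₁ ≤ ‖m₂.starProjection s - s‖ ^ 2 + p₂
      + 2 * inner ℝ (m₁.starProjection (s + N₁) - s) N₁
      + 2 * inner ℝ (s - m₂.starProjection s) N₂ := by
  have h1 := inner_starProjection_self m₁ (s + N₁)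
  have h2 := inner_starProjection_self m₂ s
  have h3 : inner ℝ (m₂.starProjection s) (m₂.starProjection (s + N₂))
      = inner ℝ (m₂.starProjection s) (s + N₂) := by
    have h := m₂.starProjection_inner_eq_zero (s + N₂) _ (m₂.starProjection_apply_mem s)
    rw [inner_sub_left, sub_eq_zero] at h
    rw [real_inner_comm, ← h, real_inner_comm]
  have h4 : 0 ≤ ‖m₂.starProjection s - m₂.starProjection (s + N₂)‖ ^ 2 := sq_nonneg _
  rw [norm_sub_sq_real, h3] at h4
  simp only [norm_sub_sq_real, inner_sub_left, inner_add_right] at *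
  linarith

theorem two_mul_inner_le {u v : H} {t : ℝ} (ht : 0 < t) :
    2 * inner ℝ u v ≤ t * ‖u‖ ^ 2 + ‖v‖ ^ 2 / t := by
  have h1 := real_inner_le_norm u v
  have h2 : t * ‖u‖ ^ 2 + ‖v‖ ^ 2 / t - 2 * (‖u‖ * ‖v‖) = (t * ‖u‖ - ‖v‖) ^ 2 / t := by
    field_simp
    ring
  have h3 : 0 ≤ (t * ‖u‖ - ‖v‖) ^ 2 / t := by positivity
  linarith

theorem norm_sub_sq_eq_of_mem {m : Submodule ℝ H} [m.HasOrthogonalProjection] {s u : H}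
    (hu : u ∈ m) :
    ‖u - s‖ ^ 2 = ‖m.starProjection s - s‖ ^ 2 + ‖u - m.starProjection s‖ ^ 2 := by
  have h := m.starProjection_inner_eq_zero s _ (m.sub_mem hu (m.starProjection_apply_mem s))
  have : u - s = (u - m.starProjection s) - (s - m.starProjection s) := by abel
  rw [this, norm_sub_sq_real, real_inner_comm, h, norm_sub_rev s]
  ring

end Deterministic

instance Model.instCountable {D : Set ℝ} {ι : Type*} [Countable ι] (φ : ι → L2 D) :
    Countable (Model φ) :=
  Function.Surjective.countable
    (f := fun J : Finset ι => (⟨Submodule.span ℝ (φ '' (J : Set ι)), J, rfl⟩ : Model φ))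
    fun ⟨_, J, hJ⟩ => ⟨J, Subtype.ext hJ.symm⟩

/-- Markov-type lower bound without measurability of `f` or `A`, since the selected model need not
depend measurably on the outcome. -/
theorem ofReal_mul_le_lintegral {Ω : Type*} [MeasurableSpace Ω] {P : Measure Ω}
    [IsProbabilityMeasure P] {A : Set Ω} {q : ℝ} (hq : 0 ≤ q)
    (hA : P A ≤ ENNReal.ofReal q) {f : Ω → ℝ≥0∞}
    {c : ℝ≥0∞} (h : ∀ᵐ ω ∂P, ω ∉ A → c ≤ f ω) :
    c * ENNReal.ofReal (1 - q) ≤ ∫⁻ ω, f ω ∂P := by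
  set T := toMeasurable P A
  have hT : MeasurableSet Tᶜ := (measurableSet_toMeasurable P A).compl
  have h1 : ENNReal.ofReal (1 - q) ≤ P Tᶜ := by
    rw [prob_compl_eq_one_sub (measurableSet_toMeasurable P A), measure_toMeasurable,
      ENNReal.ofReal_sub _ hq, ENNReal.ofReal_one]
    exact tsub_le_tsub_left hA 1
  calc c * ENNReal.ofReal (1 - q) ≤ c * P Tᶜ := by gcongr
    _ = ∫⁻ ω in Tᶜ, c ∂P := by rw [setLIntegral_const]
    _ ≤ ∫⁻ ω in Tᶜ, f ω ∂P := by
        refine lintegral_mono_ae ((ae_restrict_iff' hT).2 ?_)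
        filter_upwards [h] with ω hω hωT
        exact hω fun hωA => hωT (subset_toMeasurable P A hωA)
    _ ≤ ∫⁻ ω, f ω ∂P := setLIntegral_le_lintegral _ _

/-! ### Estimators and their losses in the white noise model. -/

section Noise

variable {D : Set ℝ} {ι : Type*} {φ : ι → L2 D} {Ω : Type*}

/-- The projection of the noise onto the sum of a model and of the line spanned by the signal. -/
noncomputable def noiseAt (W : L2 D → Ω → ℝ) (s : L2 D) (m : Model φ) (ω : Ω) : L2 D :=
  noiseVec W (m.1 ⊔ Submodule.span ℝ {s}) ω

theorem Model.finrank_sup_span_le (m : Model φ) (s : L2 D) :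
    Module.finrank ℝ (m.1 ⊔ Submodule.span ℝ {s} : Submodule ℝ (L2 D)) ≤ m.dim + 1 :=
  (Submodule.finrank_add_le_finrank_add_finrank _ _).trans
    (Nat.add_le_add_left (by
    simpa using finrank_span_le_card (R := ℝ) ({s} : Set (L2 D))) _)

theorem sHat_eq_proj_add (W : L2 D → Ω → ℝ) (n : ℕ) (s : L2 D) (m : Model φ) (ω : Ω) :
    sHat W n s m ω = m.proj s + (1 / √(n : ℝ)) • noiseVec W m.1 ω := by
  rw [Model.proj, ← sum_inner_smul_eq_starProjection m.basis, noiseVec, Finset.smul_sum]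
  exact (Finset.sum_congr rfl fun i _ => by
    rw [coeffHat, obs, add_smul, mul_smul]; rfl).trans Finset.sum_add_distrib

theorem sHat_mem (W : L2 D → Ω → ℝ) (n : ℕ) (s : L2 D) (m : Model φ) (ω : Ω) :
    sHat W n s m ω ∈ m.1 :=
  m.1.sum_mem fun i _ => m.1.smul_mem _ (m.basis i).2

theorem norm_sHat_sub_sq (W : L2 D → Ω → ℝ) (n : ℕ) (s : L2 D) (m : Model φ) (ω : Ω) :
    ‖sHat W n s m ω - s‖ ^ 2 = ‖m.proj s - s‖ ^ 2 + ‖noiseVec W m.1 ω‖ ^ 2 / n := by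
  rw [norm_sub_sq_eq_of_mem (sHat_mem W n s m ω)]
  congr 1
  change ‖_ - m.proj s‖ ^ 2 = _
  rw [sHat_eq_proj_add, add_sub_cancel_left, norm_smul, mul_pow, Real.norm_eq_abs, sq_abs,
    div_pow, one_pow, Real.sq_sqrt (Nat.cast_nonneg n)]
  ring

theorem norm_proj_sub_sq_le (W : L2 D → Ω → ℝ) (n : ℕ) (s : L2 D) (m : Model φ) (ω : Ω) :
    ‖m.proj s - s‖ ^ 2 ≤ ‖sHat W n s m ω - s‖ ^ 2 := by
  rw [norm_sHat_sub_sq]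
  exact le_add_of_nonneg_right (by positivity)

variable [MeasurableSpace Ω] {P : Measure Ω} {W : L2 D → Ω → ℝ}

theorem IsWhiteNoise.isIsonormal (hW : IsWhiteNoise W P) : IsIsonormal W P :=
  ⟨hW.gaussian, hW.centered, hW.covariance⟩

theorem IsWhiteNoise.ae_noiseAt [Countable ι] (hW : IsWhiteNoise W P) (n : ℕ) (s : L2 D) :
    ∀ᵐ ω ∂P, ∀ m : Model φ, inner ℝ s (noiseAt W s m ω) = W s ω ∧
      ∀ i, coeffHat W n s m i ω = inner ℝ (m.basis i : L2 D)
        (s + (1 / √(n : ℝ)) • noiseAt W s m ω) := by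
  refine ae_all_iff.2 fun m => ?_
  have h1 := hW.isIsonormal.inner_noiseVec_ae (m.1 ⊔ Submodule.span ℝ {s})
    (Submodule.mem_sup_right (Submodule.mem_span_singleton_self s))
  have h2 : ∀ᵐ ω ∂P, ∀ i, inner ℝ (m.basis i : L2 D)
      (noiseVec W (m.1 ⊔ Submodule.span ℝ {s}) ω) = W (m.basis i : L2 D) ω :=
    ae_all_iff.2 fun i => hW.isIsonormal.inner_noiseVec_ae _
      (Submodule.mem_sup_left (m.basis i).2)
  filter_upwards [h1, h2] with ω hω1 hω2
  refine ⟨hω1, fun i => ?_⟩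
  rw [coeffHat, obs, inner_add_right, real_inner_smul_right, noiseAt, hω2]

/-- Countability of the models gives one null set for all of them, so the deterministic inequalities
apply to a random selected model. Adjoining `s` to each subspace makes the noise component along `s`
common to all models. -/
theorem IsWhiteNoise.ae_estimator [Countable ι] (hW : IsWhiteNoise W P) (n : ℕ) (s : L2 D) :
    ∀ᵐ ω ∂P, ∀ m : Model φ, inner ℝ s (noiseAt W s m ω) = W s ω ∧
      sHat W n s m ω = m.1.starProjection (s + (1 / √(n : ℝ)) • noiseAt W s m ω) ∧
      contrastHat W n s m ω
        = -‖m.1.starProjection (s + (1 / √(n : ℝ)) • noiseAt W s m ω)‖ ^ 2 := by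
  filter_upwards [hW.ae_noiseAt (φ := φ) n s] with ω hω m
  refine ⟨(hω m).1, ?_, ?_⟩
  · rw [← sum_inner_smul_eq_starProjection m.basis]
    exact Finset.sum_congr rfl fun i _ => by rw [(hω m).2 i]
  · rw [← sum_inner_sq_eq_norm_starProjection_sq m.basis]
    exact congrArg Neg.neg (Finset.sum_congr rfl fun i _ => by rw [(hω m).2 i])

theorem IsWhiteNoise.ae_norm_sHat_sub_sq_add_le [Countable ι] (hW : IsWhiteNoise W P) (n : ℕ)
    (s : L2 D) (lam : ℕ → ℝ) :
    ∀ᵐ ω ∂P, ∀ m₁ m₂ : Model φ,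
      contrastHat W n s m₁ ω + pen lam n m₁ ≤ contrastHat W n s m₂ ω + pen lam n m₂ →
      ∀ t₁ t₂ : ℝ, 0 < t₁ → 0 < t₂ →
      ‖sHat W n s m₁ ω - s‖ ^ 2 + pen lam n m₁ ≤ ‖m₂.proj s - s‖ ^ 2 + pen lam n m₂
        + (t₁ * ‖sHat W n s m₁ ω - s‖ ^ 2 + ‖noiseAt W s m₁ ω‖ ^ 2 / n / t₁)
        + (t₂ * ‖m₂.proj s - s‖ ^ 2 + ‖noiseAt W s m₂ ω‖ ^ 2 / n / t₂) := by
  filter_upwards [hW.ae_estimator (φ := φ) n s] with ω hω m₁ m₂ h t₁ t₂ ht₁ ht₂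
  have hsq : ∀ u : L2 D, ‖(1 / √(n : ℝ)) • u‖ ^ 2 = ‖u‖ ^ 2 / n := fun u => by
    rw [norm_smul, mul_pow, Real.norm_eq_abs, sq_abs, div_pow, one_pow,
      Real.sq_sqrt (Nat.cast_nonneg n)]
    ring
  rw [(hω m₁).2.2, (hω m₂).2.2] at h
  have key := norm_sub_sq_add_le_of_contrast_le (by
    rw [real_inner_smul_right, real_inner_smul_right, (hω m₁).1, (hω m₂).1]) h
  rw [← (hω m₁).2.1] at key
  have k1 := two_mul_inner_le (u := sHat W n s m₁ ω - s)
    (v := (1 / √(n : ℝ)) • noiseAt W s m₁ ω) ht₁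
  have k2 := two_mul_inner_le (u := s - m₂.proj s)
    (v := (1 / √(n : ℝ)) • noiseAt W s m₂ ω) ht₂
  rw [hsq] at k1 k2
  rw [norm_sub_rev s] at k2
  simp only [Model.proj] at *
  linarith

end Noise

/-! ### Consequences of the Kraft sum, and elementary properties of `Q`. -/

section Collection

variable {D : Set ℝ} {ι : Type*} {φ : ι → L2 D}

/-- A model of dimension zero would alone contribute `exp 0 = 1`. -/
theorem one_le_dim_of_tsum_lt_one {S : Set (Model φ)} {c : ℝ}
    (hs : Summable fun m : S => Real.exp (-(c * (m.1.dim : ℝ) / 2)))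
    (ht : ∑' m : S, Real.exp (-(c * (m.1.dim : ℝ) / 2)) < 1) {m : Model φ} (hm : m ∈ S) :
    1 ≤ m.dim := by
  by_contra h
  have h0 : m.dim = 0 := by omega
  have := hs.le_tsum ⟨m, hm⟩ fun _ _ => (Real.exp_pos _).le
  simp only [h0, Nat.cast_zero, mul_zero, zero_div, neg_zero, Real.exp_zero] at this
  linarith

/-- The terms of models of dimension at most `d` are bounded away from zero, so summability allows
only finitely many. -/
theorem finite_dim_le_of_summable {S : Set (Model φ)} {c : ℝ} (hc : 0 ≤ c)
    (hs : Summable fun m : S => Real.exp (-(c * (m.1.dim : ℝ) / 2))) (d : ℝ) :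
    {m : Model φ | m ∈ S ∧ (m.dim : ℝ) ≤ d}.Finite := by
  have h := hs.tendsto_cofinite_zero.eventually (gt_mem_nhds (Real.exp_pos (-(c * d / 2))))
  rw [Filter.eventually_cofinite] at h
  refine (h.image Subtype.val).subset fun m hm => ⟨⟨m, hm.1⟩, ?_, rfl⟩
  simp only [Set.mem_ofPred_eq, not_lt, Real.exp_le_exp, neg_le_neg_iff]
  have := hm.2
  gcongr

theorem exists_min_of_linear_le_dim {S : Set (Model φ)} (hS : S.Nonempty)
    (hfin : ∀ d : ℝ, {m : Model φ | m ∈ S ∧ (m.dim : ℝ) ≤ d}.Finite) (f : Model φ → ℝ) {a b : ℝ}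
    (ha : 0 < a) (hf : ∀ m ∈ S, a * m.dim - b ≤ f m) :
    ∃ m ∈ S, ∀ m' ∈ S, f m ≤ f m' := by
  obtain ⟨m₁, hm₁⟩ := hS
  have hF : {m : Model φ | m ∈ S ∧ f m ≤ f m₁}.Finite :=
    (hfin ((f m₁ + b) / a)).subset fun m hm => ⟨hm.1, by
      rw [le_div_iff₀ ha]
      have := hf m hm.1
      have := hm.2
      linarith⟩
  obtain ⟨m, hm, hmin⟩ := Set.exists_min_image _ f hF ⟨m₁, hm₁, le_rfl⟩
  refine ⟨m, hm.1, fun m' hm' => ?_⟩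
  rcases le_total (f m') (f m₁) with h | h
  · exact hmin m' ⟨hm', h⟩
  · exact hm.2.trans h

theorem Q_le {M : ℕ → Set (Model φ)} {lam : ℕ → ℝ} {n : ℕ} (hlam : 0 ≤ lam n) (s : L2 D)
    {m : Model φ} (hm : m ∈ M n) : Q M lam s n ≤ ‖m.proj s - s‖ ^ 2 + lam n / n * m.dim :=
  ciInf_le (f := fun m : M n => ‖m.1.proj s - s‖ ^ 2 + lam n / n * m.1.dim)
    ⟨0, by rintro _ ⟨m, rfl⟩; positivity⟩ ⟨m, hm⟩

theorem exists_Q_eq {M : ℕ → Set (Model φ)} {lam : ℕ → ℝ} {n : ℕ} (hn : 1 ≤ n)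
    (hlam : 0 < lam n) (hne : (M n).Nonempty)
    (hfin : ∀ d : ℝ, {m : Model φ | m ∈ M n ∧ (m.dim : ℝ) ≤ d}.Finite) (s : L2 D) :
    ∃ m ∈ M n, Q M lam s n = ‖m.proj s - s‖ ^ 2 + lam n / n * m.dim ∧
      ∀ m' ∈ M n, ‖m.proj s - s‖ ^ 2 + lam n / n * m.dim
        ≤ ‖m'.proj s - s‖ ^ 2 + lam n / n * m'.dim := by
  have hn' : (0 : ℝ) < n := by exact_mod_cast hn
  obtain ⟨m, hm, hmin⟩ := exists_min_of_linear_le_dim hne hfin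
    (fun m => ‖m.proj s - s‖ ^ 2 + lam n / n * m.dim) (div_pos hlam hn') (b := 0)
    (fun m _ => by have := sq_nonneg ‖m.proj s - s‖; linarith)
  have : Nonempty (M n) := hne.to_subtype
  exact ⟨m, hm, le_antisymm (Q_le hlam.le s hm) (le_ciInf fun m' => hmin m'.1 m'.2), hmin⟩

theorem Q_le_two_mul_Q {M : ℕ → Set (Model φ)} {lam : ℕ → ℝ} {k n : ℕ} (hk : 1 ≤ k)
    (hkn : k ≤ n) (hnest : M k ⊆ M n) (hne : (M k).Nonempty) (hlk : 0 ≤ lam k) (hln : 0 ≤ lam n)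
    (hl : lam n ≤ 2 * lam k) (s : L2 D) : Q M lam s n ≤ 2 * Q M lam s k := by
  have hk' : (0 : ℝ) < k := by exact_mod_cast hk
  have : Nonempty (M k) := hne.to_subtype
  have h : Q M lam s n / 2 ≤ Q M lam s k := le_ciInf fun m => by
    have h1 := Q_le (M := M) hln s (hnest m.2)
    have h2 : lam n / n * m.1.dim ≤ 2 * (lam k / k * m.1.dim) := by
      rw [← mul_assoc, ← mul_div_assoc]
      gcongr
    have := sq_nonneg ‖m.1.proj s - s‖
    linarith
  linarith

end Collection

/-! ### Uniform noise control, existence of minimizers, and comparison of the risk with `Q`. -/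

/-- The total amount by which the squared norms of the noise, over the models of `S`, exceed
their thresholds. -/
noncomputable def noiseExcess {D : Set ℝ} {ι : Type*} {φ : ι → L2 D} {Ω : Type*}
    (W : L2 D → Ω → ℝ) (S : Set (Model φ)) (s : L2 D) (v : ℝ) (ω : Ω) : ℝ≥0∞ :=
  ∑' m : S, ENNReal.ofReal (‖noiseAt W s m.1 ω‖ ^ 2 - (m.1.dim + 1 : ℕ) * v)

section Noise

variable {D : Set ℝ} {ι : Type*} {φ : ι → L2 D} {Ω : Type*} {W : L2 D → Ω → ℝ}

theorem norm_noiseAt_sq_le {S : Set (Model φ)} {s : L2 D} {v : ℝ} {ω : Ω}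
    (h : noiseExcess W S s v ω < ∞) {m : Model φ} (hm : m ∈ S) :
    ‖noiseAt W s m ω‖ ^ 2 ≤ (m.dim + 1) * v + (noiseExcess W S s v ω).toReal := by
  have h1 : ENNReal.ofReal (‖noiseAt W s m ω‖ ^ 2 - (m.dim + 1 : ℕ) * v)
      ≤ noiseExcess W S s v ω := ENNReal.le_tsum (⟨m, hm⟩ : S)
  have h2 := (ENNReal.ofReal_le_iff_le_toReal h.ne).1 h1
  push_cast at h2
  linarith

end Noise

section Noise

variable {D : Set ℝ} {ι : Type*} {φ : ι → L2 D} {Ω : Type*} [MeasurableSpace Ω]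
  {P : Measure Ω} {W : L2 D → Ω → ℝ}

theorem IsWhiteNoise.aemeasurable_noiseAt (hW : IsWhiteNoise W P) (s : L2 D) (m : Model φ)
    (x : ℝ) : AEMeasurable (fun ω => ENNReal.ofReal (‖noiseAt W s m ω‖ ^ 2 - x)) P :=
  ((hW.isIsonormal.aemeasurable_noiseVec_sq _).sub_const x).ennreal_ofReal

theorem IsWhiteNoise.aemeasurable_noiseExcess [Countable ι] (hW : IsWhiteNoise W P)
    (S : Set (Model φ))
    (s : L2 D) (v : ℝ) : AEMeasurable (noiseExcess W S s v) P :=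
  AEMeasurable.tsum fun m => hW.aemeasurable_noiseAt s m.1 _

theorem IsWhiteNoise.lintegral_noiseAt_sub_le (hW : IsWhiteNoise W P) (m : Model φ)
    (s : L2 D) {v c : ℝ} (hv : 1 < v) (hc : c ≤ (√v - 1) ^ 2) :
    ∫⁻ ω, ENNReal.ofReal (‖noiseAt W s m ω‖ ^ 2 - (m.dim + 1 : ℕ) * v) ∂P
      ≤ ENNReal.ofReal (2 / (1 - 1 / v) * Real.exp (-(c * (m.dim : ℝ) / 2))) := by
  have hC : 0 ≤ 2 / (1 - 1 / v) := by
    have : 1 / v < 1 := by rw [div_lt_one (by linarith)]; exact hv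
    exact div_nonneg zero_le_two (by linarith)
  have h1 := hW.isIsonormal.lintegral_norm_noiseVec_sq_sub_le _ (m.finrank_sup_span_le s) hv
  refine h1.trans (ENNReal.ofReal_le_ofReal (mul_le_mul_of_nonneg_left ?_ hC))
  refine Real.exp_le_exp.2 (neg_le_neg ?_)
  have h2 : c * (m.dim : ℝ) ≤ (√v - 1) ^ 2 * ((m.dim + 1 : ℕ) : ℝ) := by
    push_cast
    nlinarith [sq_nonneg (√v - 1), mul_le_mul_of_nonneg_right hc (Nat.cast_nonneg (α := ℝ) m.dim)]
  linarith

theorem IsWhiteNoise.lintegral_noiseExcess_le [Countable ι] (hW : IsWhiteNoise W P)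
    {S : Set (Model φ)}
    (s : L2 D) {v c : ℝ} (hv : 1 < v) (hc : c ≤ (√v - 1) ^ 2)
    (hs : Summable fun m : S => Real.exp (-(c * (m.1.dim : ℝ) / 2)))
    (ht : ∑' m : S, Real.exp (-(c * (m.1.dim : ℝ) / 2)) ≤ 1) :
    ∫⁻ ω, noiseExcess W S s v ω ∂P ≤ ENNReal.ofReal (2 / (1 - 1 / v)) := by
  have hC : 0 ≤ 2 / (1 - 1 / v) := by
    have : 1 / v < 1 := by rw [div_lt_one (by linarith)]; exact hv
    exact div_nonneg zero_le_two (by linarith)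
  calc ∫⁻ ω, noiseExcess W S s v ω ∂P
      = ∑' m : S, ∫⁻ ω, ENNReal.ofReal (‖noiseAt W s m.1 ω‖ ^ 2 - (m.1.dim + 1 : ℕ) * v) ∂P :=
        lintegral_tsum fun m => hW.aemeasurable_noiseAt s m.1 _
    _ ≤ ∑' m : S, ENNReal.ofReal (2 / (1 - 1 / v) * Real.exp (-(c * (m.1.dim : ℝ) / 2))) :=
        ENNReal.tsum_le_tsum fun m => hW.lintegral_noiseAt_sub_le m.1 s hv hc
    _ = ENNReal.ofReal (2 / (1 - 1 / v) * ∑' m : S, Real.exp (-(c * (m.1.dim : ℝ) / 2))) := by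
        rw [← ENNReal.ofReal_tsum_of_nonneg
          (fun m => mul_nonneg hC (Real.exp_pos _).le) (hs.mul_left _), tsum_mul_left]
    _ ≤ _ := ENNReal.ofReal_le_ofReal (mul_le_of_le_one_right hC ht)

theorem IsWhiteNoise.ae_exists_isPenMinimizer [Countable ι] (hW : IsWhiteNoise W P)
    {M : ℕ → Set (Model φ)} {lam : ℕ → ℝ} {n : ℕ} (hn : 1 ≤ n) (hne : (M n).Nonempty)
    (hfin : ∀ d : ℝ, {m : Model φ | m ∈ M n ∧ (m.dim : ℝ) ≤ d}.Finite)
    {k c : ℝ} (hk : 1 < k) (hlam : k < lam n) (hc : c ≤ (√(lam n / k) - 1) ^ 2)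
    (hs : Summable fun m : M n => Real.exp (-(c * (m.1.dim : ℝ) / 2)))
    (ht : ∑' m : M n, Real.exp (-(c * (m.1.dim : ℝ) / 2)) ≤ 1) (s : L2 D) :
    ∀ᵐ ω ∂P, ∃ m, IsPenMinimizer W M lam n s ω m := by
  have hn' : (0 : ℝ) < n := by exact_mod_cast hn
  have hk0 : 0 < k := by linarith
  have hl0 : 0 < lam n := by linarith
  set v := lam n / k with hv
  have hv1 : 1 < v := by rw [hv, one_lt_div hk0]; exact hlam
  have hfinite := ae_lt_top' (hW.aemeasurable_noiseExcess (M n) s v)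
    ((hW.lintegral_noiseExcess_le s hv1 hc hs ht).trans_lt ENNReal.ofReal_lt_top).ne
  filter_upwards [hW.ae_estimator (φ := φ) n s, hfinite] with ω hω hT
  set T := (noiseExcess W (M n) s v ω).toReal
  -- Young's inequality with weight `(k - 1)/2` puts the factor `(k + 1)/2 < k` on the noise, so a
  -- positive fraction of the penalty survives and the criterion grows linearly in the dimension.
  obtain ⟨m, hm, hmin⟩ := exists_min_of_linear_le_dim hne hfin
    (fun m => contrastHat W n s m ω + pen lam n m) (a := lam n / n * (1 - (k + 1) / (2 * k)))
    (b := (1 + 2 / (k - 1)) * ‖s‖ ^ 2 + (k + 1) / 2 * ((v + T) / n))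
    (mul_pos (div_pos hl0 hn') (by
      rw [sub_pos, div_lt_one (by positivity)]
      linarith)) fun m hm => by
      have hN := norm_noiseAt_sq_le hT hm
      rw [(hω m).2.2, pen]
      set N := noiseAt W s m ω
      have h1 : ‖m.1.starProjection (s + (1 / √(n : ℝ)) • N)‖ ^ 2
          ≤ ‖s + (1 / √(n : ℝ)) • N‖ ^ 2 := by
        gcongr
        exact m.1.norm_starProjection_apply_le _
      have hk1 : 0 < (k - 1) / 2 := by linarith
      have h2 : ‖s + (1 / √(n : ℝ)) • N‖ ^ 2
          ≤ (1 + 2 / (k - 1)) * ‖s‖ ^ 2 + (k + 1) / 2 * (‖N‖ ^ 2 / n) := by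
        have h3 := two_mul_inner_le (u := (1 / √(n : ℝ)) • N) (v := s) hk1
        have hsq : ‖(1 / √(n : ℝ)) • N‖ ^ 2 = ‖N‖ ^ 2 / n := by
          rw [norm_smul, mul_pow, Real.norm_eq_abs, sq_abs, div_pow, one_pow,
            Real.sq_sqrt (Nat.cast_nonneg n)]
          ring
        rw [norm_add_sq_real, hsq, real_inner_comm]
        rw [hsq] at h3
        have : ‖s‖ ^ 2 / ((k - 1) / 2) = 2 / (k - 1) * ‖s‖ ^ 2 := by
          rw [div_div_eq_mul_div]; ring
        linarith
      have h4 : ‖N‖ ^ 2 / n ≤ (m.dim * v + (v + T)) / n := by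
        gcongr
        linarith
      have h5 : (k + 1) / 2 * (m.dim * v / n) = lam n / n * ((k + 1) / (2 * k)) * m.dim := by
        rw [hv]; field_simp
      have h6 := mul_le_mul_of_nonneg_left h4 (show 0 ≤ (k + 1) / 2 by linarith)
      rw [add_div ((m.dim : ℝ) * v)] at h6
      linarith
  exact ⟨m, hm, hmin⟩

theorem IsWhiteNoise.risk_le [Countable ι] (hW : IsWhiteNoise W P)
    [IsProbabilityMeasure P]
    {M : ℕ → Set (Model φ)} {lam : ℕ → ℝ} {n : ℕ} (hn : 1 ≤ n) (hne : (M n).Nonempty)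
    (hdim : ∀ m ∈ M n, 1 ≤ m.dim)
    (hfin : ∀ d : ℝ, {m : Model φ | m ∈ M n ∧ (m.dim : ℝ) ≤ d}.Finite)
    {k c v₀ : ℝ} (hk : 1 < k) (hv₀ : 1 < v₀) (hlam : v₀ ≤ lam n / k)
    (hc : c ≤ (√(lam n / k) - 1) ^ 2)
    (hs : Summable fun m : M n => Real.exp (-(c * (m.1.dim : ℝ) / 2)))
    (ht : ∑' m : M n, Real.exp (-(c * (m.1.dim : ℝ) / 2)) ≤ 1) (s : L2 D)
    {mHat : ℕ → L2 D → Ω → Model φ}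
    (hm : ∀ᵐ ω ∂P, IsPenMinimizer W M lam n s ω (mHat n s ω)) :
    risk P W mHat n s ≤ ENNReal.ofReal
      ((4 + (k + 1) * (2 / (1 - 1 / v₀))) / (1 - 1 / k) * Q M lam s n) := by
  have hn' : (0 : ℝ) < n := by exact_mod_cast hn
  have hk0 : 0 < k := by linarith
  set v := lam n / k with hv
  have hlv : lam n = k * v := by rw [hv]; field_simp
  have hv1 : 1 < v := by linarith
  have hl1 : 1 < lam n := by rw [hlv]; nlinarith
  have hE := hW.lintegral_noiseExcess_le s hv1 hc hs ht
  have hfinite := ae_lt_top' (hW.aemeasurable_noiseExcess (M n) s v)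
    (hE.trans_lt ENNReal.ofReal_lt_top).ne
  obtain ⟨m', hm', hQ, -⟩ := exists_Q_eq hn (by linarith) hne hfin s
  have hθ : 0 < 1 - 1 / k := by
    rw [sub_pos, div_lt_one hk0]; exact hk
  have hQ0 : 0 ≤ Q M lam s n := by
    rw [hQ]; positivity
  have hpt : ∀ᵐ ω ∂P, ENNReal.ofReal (‖sHat W n s (mHat n s ω) ω - s‖ ^ 2)
      ≤ ENNReal.ofReal (4 * Q M lam s n / (1 - 1 / k))
        + ENNReal.ofReal ((k + 1) / n / (1 - 1 / k)) * noiseExcess W (M n) s v ω := by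
    filter_upwards [hW.ae_norm_sHat_sub_sq_add_le (φ := φ) n s lam, hfinite, hm] with ω hω hT hmin
    rw [← ENNReal.ofReal_toReal hT.ne, ← ENNReal.ofReal_mul (by positivity),
      ← ENNReal.ofReal_add (by positivity) (by positivity)]
    refine ENNReal.ofReal_le_ofReal ?_
    have hN1 := norm_noiseAt_sq_le hT hmin.1
    have hN2 := norm_noiseAt_sq_le hT hm'
    -- The weight `1/k` charges the selected model `k ‖N‖² / n`, which its penalty cancels since `k
    -- v = lam n`, up to `lam n / n` and the excess; a fraction `1 - 1/k` of the loss remains.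
    have h := hω _ m' (hmin.2 m' hm') (1 / k) 1 (by positivity) one_pos
    set T := (noiseExcess W (M n) s v ω).toReal
    have hT0 : 0 ≤ T := ENNReal.toReal_nonneg
    set mh := mHat n s ω
    set r := ‖sHat W n s mh ω - s‖ ^ 2
    have e1 : ‖noiseAt W s mh ω‖ ^ 2 / n / (1 / k) ≤ lam n / n * mh.dim + lam n / n + k * T / n := by
      calc ‖noiseAt W s mh ω‖ ^ 2 / n / (1 / k) = k * ‖noiseAt W s mh ω‖ ^ 2 / n := by
            field_simp
        _ ≤ k * ((mh.dim + 1) * v + T) / n := by gcongr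
        _ = _ := by rw [hlv]; ring
    have e2 : ‖noiseAt W s m' ω‖ ^ 2 / n ≤ lam n / n * m'.dim + lam n / n + T / n := by
      calc ‖noiseAt W s m' ω‖ ^ 2 / n ≤ ((m'.dim + 1) * v + T) / n := by gcongr
        _ ≤ ((m'.dim + 1) * lam n + T) / n := by
            gcongr
            rw [hlv]
            nlinarith
        _ = _ := by ring
    have hd : lam n / n ≤ lam n / n * m'.dim := by
      have : (1 : ℝ) ≤ m'.dim := by exact_mod_cast hdim m' hm'
      exact le_mul_of_one_le_right (by positivity) this
    have h3 : (1 - 1 / k) * r ≤ 4 * Q M lam s n + (k + 1) / n * T := by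
      rw [hQ]
      simp only [pen, div_one] at h
      have e3 : k * T / n + T / n = (k + 1) / n * T := by ring
      have := sq_nonneg ‖m'.proj s - s‖
      linarith
    rw [div_mul_eq_mul_div, ← add_div, le_div_iff₀ hθ, mul_comm]
    exact h3
  refine (lintegral_mono_ae hpt).trans ?_
  have hE' : ∫⁻ ω, noiseExcess W (M n) s v ω ∂P ≤ ENNReal.ofReal (2 / (1 - 1 / v₀)) := by
    refine hE.trans (ENNReal.ofReal_le_ofReal ?_)
    have : 0 < 1 - 1 / v₀ := by
      rw [sub_pos, div_lt_one (by linarith)]; exact hv₀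
    gcongr
  rw [lintegral_add_left measurable_const, lintegral_const, measure_univ, mul_one,
    lintegral_const_mul' _ _ ENNReal.ofReal_ne_top]
  refine (add_le_add_right (mul_le_mul_right hE' _) _).trans ?_
  have hv2 : 0 < 2 / (1 - 1 / v₀) := by
    have : 0 < 1 - 1 / v₀ := by
      rw [sub_pos, div_lt_one (by linarith)]; exact hv₀
    positivity
  rw [← ENNReal.ofReal_mul (by positivity), ← ENNReal.ofReal_add (by positivity) (by positivity)]
  refine ENNReal.ofReal_le_ofReal ?_
  -- Since dimensions are at least one and `lam n > 1`, the residual of order `1/n` from the excess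
  -- is absorbed by `Q`.
  have hQ1 : 1 / n ≤ Q M lam s n := by
    rw [hQ]
    have : (1 : ℝ) ≤ m'.dim := by exact_mod_cast hdim m' hm'
    have h1 : (1 : ℝ) / n ≤ lam n / n := by gcongr
    have h2 : lam n / n ≤ lam n / n * m'.dim := le_mul_of_one_le_right (by positivity) this
    have := sq_nonneg ‖m'.proj s - s‖
    linarith
  calc 4 * Q M lam s n / (1 - 1 / k) + (k + 1) / n / (1 - 1 / k) * (2 / (1 - 1 / v₀))
      = (4 * Q M lam s n + (k + 1) * (2 / (1 - 1 / v₀)) * (1 / n)) / (1 - 1 / k) := by ring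
    _ ≤ (4 * Q M lam s n + (k + 1) * (2 / (1 - 1 / v₀)) * Q M lam s n) / (1 - 1 / k) := by
        gcongr
    _ = _ := by ring

theorem measure_iUnion_le_of_summable [Countable ι] {S : Set (Model φ)}
    {A : S → Set Ω} {f : S → ℝ} {q : ℝ}
    (hA : ∀ m, P (A m) ≤ ENNReal.ofReal (f m)) (hf : ∀ m, 0 ≤ f m) (hs : Summable f)
    (ht : ∑' m, f m ≤ q) : P (⋃ m, A m) ≤ ENNReal.ofReal q := by
  refine (measure_iUnion_le A).trans ((ENNReal.tsum_le_tsum hA).trans ?_)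
  rw [← ENNReal.ofReal_tsum_of_nonneg hf hs]
  exact ENNReal.ofReal_le_ofReal ht

/-- Off an event of probability at most `q`, every model has noise of order at least its dimension,
so the variance part of the loss recovers the penalty up to a factor. This factor degenerates as
`lam n` or `c` grows, so the bound serves only finitely many `n`. -/
theorem IsWhiteNoise.ofReal_mul_Q_le_risk [Countable ι] (hW : IsWhiteNoise W P)
    [IsProbabilityMeasure P]
    {M : ℕ → Set (Model φ)} {lam : ℕ → ℝ} {n : ℕ} (hn : 1 ≤ n) (hlam : 0 < lam n)
    {c q : ℝ} (hc : 0 ≤ c) (hq : 0 ≤ q)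
    (hs : Summable fun m : M n => Real.exp (-(c * (m.1.dim : ℝ) / 2)))
    (ht : ∑' m : M n, Real.exp (-(c * (m.1.dim : ℝ) / 2)) ≤ q) (s : L2 D)
    {mHat : ℕ → L2 D → Ω → Model φ} (hm : ∀ᵐ ω ∂P, mHat n s ω ∈ M n) :
    ENNReal.ofReal (min 1 (1 / (lam n * (Real.exp (1 + c) - 1))) * Q M lam s n)
      * ENNReal.ofReal (1 - q) ≤ risk P W mHat n s := by
  have hn' : (0 : ℝ) < n := by exact_mod_cast hn
  have hx : 0 < Real.exp (1 + c) - 1 := by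
    have := Real.add_one_le_exp (1 + c)
    linarith
  set x := Real.exp (1 + c) - 1 with hx_def
  refine ofReal_mul_le_lintegral hq
    (A := ⋃ m : M n, {ω | ‖noiseVec W m.1.1 ω‖ ^ 2 ≤ m.1.dim / x})
    (measure_iUnion_le_of_summable
      (fun m => hW.isIsonormal.measure_norm_noiseVec_sq_le m.1.1 hc) (fun m => by positivity)
      hs ht) ?_
  filter_upwards [hm] with ω hω hA
  refine ENNReal.ofReal_le_ofReal ?_
  set m := mHat n s ω
  have h1 : (m.dim : ℝ) / x < ‖noiseVec W m.1 ω‖ ^ 2 := by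
    by_contra h
    exact hA (Set.mem_iUnion.2 ⟨⟨m, hω⟩, not_lt.1 h⟩)
  have hm1 : min 1 (1 / (lam n * x)) ≤ 1 := min_le_left _ _
  have hm2 : min 1 (1 / (lam n * x)) ≤ 1 / (lam n * x) := min_le_right _ _
  have hm0 : 0 ≤ min 1 (1 / (lam n * x)) := le_min zero_le_one (by positivity)
  rw [norm_sHat_sub_sq]
  calc min 1 (1 / (lam n * x)) * Q M lam s n
      ≤ min 1 (1 / (lam n * x)) * (‖m.proj s - s‖ ^ 2 + lam n / n * m.dim) := by
        gcongr
        exact Q_le hlam.le s hω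
    _ = min 1 (1 / (lam n * x)) * ‖m.proj s - s‖ ^ 2
        + min 1 (1 / (lam n * x)) * (lam n / n * m.dim) := mul_add _ _ _
    _ ≤ 1 * ‖m.proj s - s‖ ^ 2 + 1 / (lam n * x) * (lam n / n * m.dim) := by gcongr
    _ = ‖m.proj s - s‖ ^ 2 + m.dim / x / n := by field_simp
    _ ≤ _ := by gcongr

/-- With positive probability the bias of a minimizer of a weakly penalized criterion is bounded by
the loss of the selected estimator, up to a small fraction of its penalty. -/
theorem IsWhiteNoise.ofReal_bias_sub_le_risk [Countable ι] (hW : IsWhiteNoise W P)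
    [IsProbabilityMeasure P]
    {M : ℕ → Set (Model φ)} {lam : ℕ → ℝ} {n : ℕ} (hn : 1 ≤ n) (hlam : 2 ≤ lam n)
    (hdim : ∀ m ∈ M n, 1 ≤ m.dim)
    {c q : ℝ} (hc : c ≤ lam n) (hq : 0 ≤ q)
    (hs : Summable fun m : M n => Real.exp (-(c * (m.1.dim : ℝ) / 2)))
    (ht : ∑' m : M n, Real.exp (-(c * (m.1.dim : ℝ) / 2)) ≤ q) (s : L2 D)
    {mHat : ℕ → L2 D → Ω → Model φ}
    (hm : ∀ᵐ ω ∂P, IsPenMinimizer W M lam n s ω (mHat n s ω))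
    {g : ℝ} (hg : 0 < g) (hg1 : g ≤ 1) {a : ℝ} (ha : a = 1 / (4 * (1 + 64 / g)))
    {m : Model φ} (hmM : m ∈ M n)
    (hmin : ∀ m' ∈ M n, ‖m.proj s - s‖ ^ 2 + a * lam n / n * m.dim
        ≤ ‖m'.proj s - s‖ ^ 2 + a * lam n / n * m'.dim) :
    ENNReal.ofReal ((‖m.proj s - s‖ ^ 2 - g / 4 * (a * lam n / n * m.dim)) / 3)
      * ENNReal.ofReal (1 - q) ≤ risk P W mHat n s := by
  have hn' : (0 : ℝ) < n := by exact_mod_cast hn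
  refine ofReal_mul_le_lintegral hq
    (A := ⋃ m : M n, {ω | 4 * lam n * m.1.dim ≤ ‖noiseAt W s m.1 ω‖ ^ 2})
    (measure_iUnion_le_of_summable (fun m =>
      (hW.isIsonormal.measure_mul_le_norm_noiseVec_sq _ (hdim m.1 m.2)
        (m.1.finrank_sup_span_le s) hlam).trans (ENNReal.ofReal_le_ofReal
          (Real.exp_le_exp.2 (by gcongr)))) (fun m => by positivity) hs ht) ?_
  filter_upwards [hm, hW.ae_norm_sHat_sub_sq_add_le (φ := φ) n s lam] with ω hmh hω hA
  refine ENNReal.ofReal_le_ofReal ?_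
  have hN : ∀ m ∈ M n, ‖noiseAt W s m ω‖ ^ 2 / n ≤ 4 * (lam n / n * m.dim) := fun m hmem => by
    have h1 : ‖noiseAt W s m ω‖ ^ 2 < 4 * lam n * m.dim := by
      by_contra h
      exact hA (Set.mem_iUnion.2 ⟨⟨m, hmem⟩, not_lt.1 h⟩)
    calc ‖noiseAt W s m ω‖ ^ 2 / n ≤ 4 * lam n * m.dim / n := by gcongr
      _ = _ := by ring
  set mh := mHat n s ω
  have hK : 0 < 64 / g := by positivity
  -- The large weight `64/g` shrinks the noise, at most four penalties on this event, to `g/16` of a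
  -- penalty; the price is a large factor on the errors, which `a (1 + 64/g) = 1/4` compensates
  -- below.
  have h := hω mh m (hmh.2 m hmM) (64 / g) (64 / g) hK hK
  have hN1 := hN mh hmh.1
  have hN2 := hN m hmM
  have hb := (hmin mh hmh.1).trans (add_le_add_left (norm_proj_sub_sq_le W n s mh ω) _)
  have ha0 : 0 < a := by rw [ha]; positivity
  have ha1 : a * (1 + 64 / g) = 1 / 4 := by rw [ha]; field_simp
  simp only [pen] at h
  rw [show a * lam n / n * m.dim = a * (lam n / n * m.dim) by ring] at hb ⊢
  rw [show a * lam n / n * mh.dim = a * (lam n / n * mh.dim) by ring] at hb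
  have f1 : ‖noiseAt W s mh ω‖ ^ 2 / n / (64 / g) ≤ g / 16 * (lam n / n * mh.dim) := by
    rw [div_le_iff₀ hK]
    calc _ ≤ _ := hN1
      _ = _ := by field_simp; ring
  have f2 : ‖noiseAt W s m ω‖ ^ 2 / n / (64 / g) ≤ g / 16 * (lam n / n * m.dim) := by
    rw [div_le_iff₀ hK]
    calc _ ≤ _ := hN2
      _ = _ := by field_simp; ring
  have hp0 : 0 ≤ lam n / n * (m.dim : ℝ) := by positivity
  have hp1 : 0 ≤ lam n / n * (mh.dim : ℝ) := by positivity
  have hb0 := sq_nonneg ‖m.proj s - s‖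
  have hr0 := sq_nonneg ‖sHat W n s mh ω - s‖
  set b := ‖m.proj s - s‖ ^ 2
  set r := ‖sHat W n s mh ω - s‖ ^ 2
  set p := lam n / n * (m.dim : ℝ)
  set ph := lam n / n * (mh.dim : ℝ)
  set K := 64 / g
  -- The penalty of the selected model is bounded here; scaled by `a`, it is inserted into the
  -- minimality `b + a p ≤ r + a ph` of `m`, leaving a bound on `b` by `r` and a small multiple of
  -- `a p`.
  have h' : (1 - g / 16) * ph ≤ (1 + K) * b + (1 + g / 16) * p + (K - 1) * r := by linarith
  have h2 := mul_le_mul_of_nonneg_left h' ha0.le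
  have h3 := mul_le_mul_of_nonneg_left hb (show 0 ≤ 1 - g / 16 by linarith)
  have h4 : a * ((1 + K) * b) = 1 / 4 * b := by rw [← mul_assoc, ha1]
  have h5 : a * ((K - 1) * r) ≤ 1 / 4 * r := by
    rw [← ha1]
    nlinarith [mul_nonneg ha0.le hr0]
  have h6 : 0 ≤ a * p := by positivity
  rw [div_le_iff₀ (by norm_num)]
  have h7 : (1 - g / 16) * b + (1 - g / 16) * (a * p)
      ≤ (1 - g / 16) * r + (1 / 4 * b + (1 + g / 16) * (a * p) + 1 / 4 * r) := by
    linarith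
  have h8 : g * r ≥ 0 := by positivity
  have h9 : 1 / 2 * b ≤ (1 - g / 16 - 1 / 4) * b := by
    gcongr; linarith
  linarith

end Noise

/-! ### The constants `g`, `Υ` and the slack given by `κ`. -/

section Constants

/-- By concavity it suffices that the derivative `a t^(a-1)` is at most 1; for `t ≥ 1/2` it is at
most `a 2^(1-a) ≤ a (2 - a) ≤ 1`, Bernoulli's inequality giving the middle step. -/
theorem rpow_sub_self_le {a t u : ℝ} (ha0 : 0 ≤ a) (ha1 : a ≤ 1) (ht : 1 / 2 ≤ t) (htu : t ≤ u) :
    u ^ a - u ≤ t ^ a - t := by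
  have ht0 : 0 < t := by linarith
  have h1 : (u / t) ^ a ≤ 1 + a * (u / t - 1) := by
    have := rpow_one_add_le_one_add_mul_self (s := u / t - 1) (by
      have : 0 ≤ u / t := div_nonneg (by linarith) ht0.le
      linarith) ha0 ha1
    rwa [add_sub_cancel] at this
  have h2 : a * t ^ a ≤ t := by
    have h3 : (t⁻¹) ^ (1 - a) ≤ 2 ^ (1 - a) := by
      refine Real.rpow_le_rpow (by positivity) ?_ (by linarith)
      rw [inv_le_comm₀ ht0 two_pos]
      linarith
    have h4 : (2 : ℝ) ^ (1 - a) ≤ 2 - a := by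
      have := rpow_one_add_le_one_add_mul_self (s := 1) (p := 1 - a) (by norm_num)
        (by linarith) (by linarith)
      rw [one_add_one_eq_two] at this
      linarith
    have h5 : t ^ a = t * (t⁻¹) ^ (1 - a) := by
      rw [Real.inv_rpow ht0.le, Real.rpow_sub ht0, Real.rpow_one, inv_div]
      field_simp
    have h6 : a * (t⁻¹) ^ (1 - a) ≤ 1 := by nlinarith [h3.trans h4]
    rw [h5]
    nlinarith
  have h7 : u ^ a = t ^ a * (u / t) ^ a := by
    rw [Real.div_rpow (by linarith) ht0.le]
    field_simp
  have h8 : t ^ a * (u / t) ^ a ≤ t ^ a * (1 + a * (u / t - 1)) := by gcongr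
  have h9 : a * t ^ a * (u / t - 1) ≤ t * (u / t - 1) := by
    refine mul_le_mul_of_nonneg_right h2 ?_
    rw [sub_nonneg, le_div_iff₀ ht0]
    linarith
  have h10 : t * (u / t - 1) = u - t := by field_simp
  linarith

/-- The worst case is `t = 1 - δ` and `α = α₀`: the difference decreases in `t`, and a smaller
exponent only increases the power. -/
theorem gConst_le_rpow_sub {δ α₀ α t : ℝ} (hα : 0 < α) (hαα : α ≤ α₀) (hδ0 : 0 < δ)
    (ht : 1 / 2 ≤ t) (htδ : t ≤ 1 - δ) :
    gConst δ α₀ ≤ t ^ (2 * α / (1 + 2 * α)) - t := by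
  have hα₀ : 0 < α₀ := by linarith
  have h1 : 2 * α / (1 + 2 * α) ≤ 2 * α₀ / (2 * α₀ + 1) := by
    rw [div_le_div_iff₀ (by positivity) (by positivity)]
    nlinarith
  have h2 := rpow_sub_self_le (a := 2 * α₀ / (2 * α₀ + 1)) (by positivity)
    (by rw [div_le_one (by positivity)]; linarith) ht htδ
  have h3 := Real.rpow_le_rpow_of_exponent_ge (by linarith) (by linarith : t ≤ 1) h1
  exact h2.trans (by linarith)

theorem gConst_pos {δ α₀ : ℝ} (hα₀ : 0 < α₀) (hδ0 : 0 < δ) (hδ : δ ≤ 1 / 2) :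
    0 < gConst δ α₀ := by
  have h := Real.rpow_lt_rpow_of_exponent_gt (x := 1 - δ) (by linarith) (by linarith)
    (show 2 * α₀ / (2 * α₀ + 1) < 1 by rw [div_lt_one (by positivity)]; linarith)
  rw [Real.rpow_one] at h
  exact sub_pos.2 h

theorem gConst_le_half {δ α₀ : ℝ} (hα₀ : 0 < α₀) (hδ0 : 0 < δ) (hδ : δ ≤ 1 / 2) :
    gConst δ α₀ ≤ 1 / 2 := by
  have h := Real.rpow_le_one (x := 1 - δ) (z := 2 * α₀ / (2 * α₀ + 1)) (by linarith)
    (by linarith) (by positivity)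
  rw [gConst]
  linarith

theorem le_Upsilon {δ α₀ p : ℝ} (hα₀ : 0 < α₀) (hδ0 : 0 < δ) (hδ : δ ≤ 1 / 2) (hp0 : 0 < p)
    (hp1 : p < 1) : 8 ≤ Upsilon δ p α₀ := by
  have h0 := gConst_pos hα₀ hδ0 hδ
  have h1 := gConst_le_half hα₀ hδ0 hδ
  have h2 : 8 ≤ 8 / (p * gConst δ α₀) := by
    rw [le_div_iff₀ (by positivity)]
    nlinarith
  have h3 : 1 ≤ 16 / gConst δ α₀ + 1 := le_add_of_nonneg_left (by positivity)
  rw [Upsilon]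
  nlinarith

theorem sqrt_div_sub_one_sq_le_self {l κ : ℝ} (hκ : 1 < κ) (hl : 1 ≤ l) :
    (√(l / κ) - 1) ^ 2 ≤ l := by
  have h1 : l / κ ≤ l := div_le_self (by linarith) hκ.le
  have h2 := Real.sq_sqrt (show 0 ≤ l / κ by positivity)
  have h3 := Real.sqrt_nonneg (l / κ)
  rcases le_total 1 (√(l / κ)) with h | h <;> nlinarith

/-- Squaring is monotone once the smaller root is at least 1. Otherwise `l ≥ 8` and the cap at 2
make the larger root at least 2, so the right side is at least 1. -/
theorem sqrt_div_sub_one_sq_le {l κ : ℝ} (hκ : 1 < κ) (hl : 8 ≤ l ∨ κ ≤ l) :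
    (√(l / κ) - 1) ^ 2 ≤ (√(l / min (√κ) 2) - 1) ^ 2 := by
  have hs : 1 < √κ := Real.lt_sqrt_of_sq_lt (by linarith)
  have hk0 : 0 < min (√κ) 2 := lt_min (by linarith) two_pos
  have hl0 : 0 < l := by rcases hl with h | h <;> linarith
  have hle : √(l / κ) ≤ √(l / min (√κ) 2) := by
    refine Real.sqrt_le_sqrt (div_le_div_of_nonneg_left hl0.le hk0 ((min_le_left _ _).trans ?_))
    exact (Real.sqrt_le_left (by linarith)).2 (by nlinarith)
  have h0 := Real.sqrt_nonneg (l / κ)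
  rcases le_total 1 (√(l / κ)) with h | h
  · exact pow_le_pow_left₀ (by linarith) (by linarith) 2
  rcases hl with hl | hl
  · have h2 : 2 ≤ √(l / min (√κ) 2) := by
      refine Real.le_sqrt_of_sq_le ?_
      rw [le_div_iff₀ hk0]
      linarith [min_le_right (√κ) 2]
    nlinarith
  · have h1 : 1 ≤ √(l / κ) := Real.one_le_sqrt.2 ((one_le_div (by linarith)).2 hl)
    exact pow_le_pow_left₀ (by linarith) (by linarith) 2

theorem min_sqrt_two_le_div {l κ : ℝ} (hκ : 1 < κ) (hl : 8 ≤ l ∨ κ ≤ l) :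
    min (√κ) 2 ≤ l / min (√κ) 2 := by
  have hs : 1 < √κ := Real.lt_sqrt_of_sq_lt (by linarith)
  have hk0 : 0 < min (√κ) 2 := lt_min (by linarith) two_pos
  have h2 := Real.sq_sqrt (show 0 ≤ κ by linarith)
  have h3 := min_le_left (√κ) 2
  have h4 := min_le_right (√κ) 2
  rw [le_div_iff₀ hk0]
  rcases hl with hl | hl <;> nlinarith

end Constants

/-! ### Rates and the doubling induction. -/

section Rates

theorem rate_pos {lam : ℕ → ℝ} {n : ℕ} (hn : 1 ≤ n) (hlam : 0 < lam n) (α : ℝ) :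
    0 < rate lam α n :=
  Real.rpow_pos_of_pos (div_pos hlam (by exact_mod_cast hn)) _

theorem rate_sq {lam : ℕ → ℝ} {n : ℕ} (hlam : 0 ≤ lam n) (α : ℝ) :
    rate lam α n ^ 2 = (lam n / n) ^ (2 * α / (1 + 2 * α)) := by
  rw [rate, ← Real.rpow_mul_natCast (by positivity)]
  congr 1
  push_cast
  ring

theorem supRate_le_ofReal_iff {ρ : ℕ → ℝ} (hρ : ∀ n, 1 ≤ n → 0 < ρ n) {f : ℕ → ℝ≥0∞} {B : ℝ} :
    supRate ρ f ≤ ENNReal.ofReal B ↔ ∀ n, 1 ≤ n → f n ≤ ENNReal.ofReal (B * ρ n ^ 2) := by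
  simp only [supRate, iSup_le_iff]
  refine forall₂_congr fun n hn => ?_
  have h : 0 < ρ n ^ 2 := pow_pos (hρ n hn) 2
  rw [ENNReal.ofReal_inv_of_pos h, ENNReal.ofReal_mul' h.le, mul_comm, ← div_eq_mul_inv]
  exact ENNReal.div_le_iff (ENNReal.ofReal_pos.2 h).ne' ENNReal.ofReal_ne_top

/-- A sequence that nearly contracts along doublings is dominated by the square of the rate. -/
theorem le_mul_rate_sq_of_doubling {lam : ℕ → ℝ} (hpos : ∀ n, 1 ≤ n → 0 < lam n)
    (hmono : ∀ k n, 1 ≤ k → k ≤ n → lam k ≤ lam n) {α₀ α δ : ℝ} {n₀ : ℕ} (hn₀ : 1 ≤ n₀)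
    (hα : 0 < α) (hαα : α ≤ α₀) (hδ0 : 0 < δ) (hδ : δ ≤ 1 / 2)
    (hdouble : ∀ n, n₀ ≤ n → lam (2 * n) ≤ 2 * (1 - δ) * lam n) {q : ℕ → ℝ} {B C₁ C₂ : ℝ}
    (hB : 0 ≤ B) (hC₁ : 0 ≤ C₁)
    (h2 : ∀ n, n₀ ≤ n → q (2 * n)
      ≤ (lam (2 * n) / (2 * lam n) + gConst δ α₀ / 4) * q n + C₂ * (B * rate lam α n ^ 2))
    (hle : ∀ k n, n₀ ≤ k → k ≤ n → n ≤ 2 * k → q n ≤ 2 * q k)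
    (h0 : q n₀ ≤ C₁ * (B * rate lam α n₀ ^ 2)) :
    ∀ n, n₀ ≤ n → q n ≤ 4 * max C₁ (2 * C₂ / gConst δ α₀) * (B * rate lam α n ^ 2) := by
  have hg := gConst_pos (lt_of_lt_of_le hα hαα) hδ0 hδ
  set g := gConst δ α₀ with hg_def
  set X := max C₁ (2 * C₂ / g)
  have hX0 : 0 ≤ X := hC₁.trans (le_max_left _ _)
  have hX1 : 2 * C₂ ≤ X * g := (div_le_iff₀ hg).1 (le_max_right _ _)
  have hdyadic : ∀ j : ℕ, q (2 ^ j * n₀) ≤ X * (B * rate lam α (2 ^ j * n₀) ^ 2) := fun j => by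
    induction j with
    | zero =>
      rw [pow_zero, one_mul]
      exact h0.trans (by gcongr; exact le_max_left _ _)
    | succ j ih =>
      rw [pow_succ', mul_assoc]
      set n := 2 ^ j * n₀
      have hn : n₀ ≤ n := Nat.le_mul_of_pos_left _ (by positivity)
      have hn1 : 1 ≤ n := hn₀.trans hn
      have hl := hpos n hn1
      have hn' : (0 : ℝ) < n := by exact_mod_cast hn1
      set t := lam (2 * n) / (2 * lam n) with ht
      have ht1 : 1 / 2 ≤ t := by
        rw [ht, le_div_iff₀ (by positivity)]
        linarith [hmono n (2 * n) hn1 (by omega)]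
      have ht2 : t ≤ 1 - δ := by
        rw [ht, div_le_iff₀ (by positivity)]
        linarith [hdouble n hn]
      have hgt := gConst_le_rpow_sub hα hαα hδ0 ht1 ht2
      have hr : rate lam α (2 * n) ^ 2
          = t ^ (2 * α / (1 + 2 * α)) * rate lam α n ^ 2 := by
        rw [rate_sq (hpos _ (by omega)).le, rate_sq hl.le, ← Real.mul_rpow (by positivity)
          (by positivity)]
        congr 1
        rw [ht]
        push_cast
        field_simp
      rw [hr]
      refine (h2 n hn).trans ?_
      have hy : 0 ≤ B * rate lam α n ^ 2 := by positivity
      set y := B * rate lam α n ^ 2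
      -- The gap `g` between `t` and its power pays `g/4` for the perturbation and, by the choice of
      -- `X`, `g/2` for the risk term.
      calc (t + g / 4) * q n + C₂ * y ≤ (t + g / 4) * (X * y) + X * g / 2 * y := by
            gcongr
            linarith
        _ = (t + 3 * g / 4) * (X * y) := by ring
        _ ≤ t ^ (2 * α / (1 + 2 * α)) * (X * y) := by
            gcongr
            linarith
        _ = X * (B * (t ^ (2 * α / (1 + 2 * α)) * rate lam α n ^ 2)) := by ring
  intro n hn
  -- `2^j * n₀` is the largest dyadic multiple of `n₀` not exceeding `n`; passing to `n` costs a
  -- factor 2 for `q` and 2 for the squared rate.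
  set j := Nat.log 2 (n / n₀)
  have hdiv : n / n₀ ≠ 0 := (Nat.div_pos hn hn₀).ne'
  have h3 : 2 ^ j * n₀ ≤ n := (Nat.le_div_iff_mul_le hn₀).1 (Nat.pow_log_le_self 2 hdiv)
  have h4 : n ≤ 2 * (2 ^ j * n₀) := by
    have := (Nat.div_lt_iff_lt_mul hn₀).1 (Nat.lt_pow_succ_log_self (b := 2) one_lt_two (n / n₀))
    rw [Nat.pow_succ] at this
    linarith
  have hkj := hdyadic j
  set k := 2 ^ j * n₀
  have hk : n₀ ≤ k := Nat.le_mul_of_pos_left _ (by positivity)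
  have hk1 : 1 ≤ k := hn₀.trans hk
  have hk' : (0 : ℝ) < k := by exact_mod_cast hk1
  have hn' : (0 : ℝ) < n := by exact_mod_cast hk1.trans h3
  have hr : rate lam α k ^ 2 ≤ 2 * rate lam α n ^ 2 := by
    have hb := hpos n (hk1.trans h3)
    rw [rate_sq (hpos k hk1).le, rate_sq hb.le]
    have e1 : 2 * α / (1 + 2 * α) ≤ 1 := by rw [div_le_one (by positivity)]; linarith
    have e2 : lam k / k ≤ 2 * (lam n / n) := by
      have h4' : (n : ℝ) ≤ 2 * k := by exact_mod_cast h4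
      rw [← mul_div_assoc, div_le_div_iff₀ hk' hn']
      nlinarith [hmono k n hk1 h3, hpos k hk1]
    calc (lam k / k) ^ (2 * α / (1 + 2 * α)) ≤ (2 * (lam n / n)) ^ (2 * α / (1 + 2 * α)) :=
          Real.rpow_le_rpow (div_pos (hpos k hk1) hk').le e2 (by positivity)
      _ = 2 ^ (2 * α / (1 + 2 * α)) * (lam n / n) ^ (2 * α / (1 + 2 * α)) :=
          Real.mul_rpow two_pos.le (by positivity)
      _ ≤ 2 ^ (1 : ℝ) * (lam n / n) ^ (2 * α / (1 + 2 * α)) := by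
          gcongr
          norm_num
      _ = _ := by rw [Real.rpow_one]
  calc q n ≤ 2 * q k := hle k n hk h3 h4
    _ ≤ 2 * (X * (B * (2 * rate lam α n ^ 2))) := by
        gcongr
        exact hkj.trans (by gcongr)
    _ = _ := by ring

end Rates

theorem le_div_of_ofReal_mul_le {x y z : ℝ} (hy : 0 < y) (hz : 0 ≤ z)
    (h : ENNReal.ofReal x * ENNReal.ofReal y ≤ ENNReal.ofReal z) : x ≤ z / y := by
  rw [← ENNReal.ofReal_mul' hy.le, ENNReal.ofReal_le_ofReal_iff hz] at h
  rwa [le_div_iff₀ hy]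

/-! ### From risk comparison to equality of sets and balls. -/

section Maxiset

variable {D : Set ℝ} {ι : Type*} {φ : ι → L2 D} {Ω : Type*} [MeasurableSpace Ω]
  {P : Measure Ω} {W : L2 D → Ω → ℝ}

theorem Q_const_mul_le {M : ℕ → Set (Model φ)} {lam : ℕ → ℝ} {n : ℕ} (hlam : 0 ≤ lam n)
    (hne : (M n).Nonempty) {a : ℝ} (ha0 : 0 ≤ a) (ha1 : a ≤ 1) (s : L2 D) :
    Q M (fun n => a * lam n) s n ≤ Q M lam s n := by
  have : Nonempty (M n) := hne.to_subtype
  refine le_ciInf fun m => (Q_le (mul_nonneg ha0 hlam) s m.2).trans ?_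
  gcongr
  exact mul_le_of_le_one_left hlam ha1

theorem mul_Q_le_Q_const_mul {M : ℕ → Set (Model φ)} {lam : ℕ → ℝ} {n : ℕ} (hlam : 0 ≤ lam n)
    (hne : (M n).Nonempty) {a : ℝ} (ha0 : 0 ≤ a) (ha1 : a ≤ 1) (s : L2 D) :
    a * Q M lam s n ≤ Q M (fun n => a * lam n) s n := by
  have : Nonempty (M n) := hne.to_subtype
  refine le_ciInf fun m => ?_
  calc a * Q M lam s n ≤ a * (‖m.1.proj s - s‖ ^ 2 + lam n / n * m.1.dim) := by
        gcongr
        exact Q_le hlam s m.2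
    _ = a * ‖m.1.proj s - s‖ ^ 2 + a * lam n / n * m.1.dim := by ring
    _ ≤ _ := by
        gcongr
        exact mul_le_of_le_one_left (sq_nonneg _) ha1

/-- Equality of the maxiset and of the approximation set, with equivalence of balls, follows from a
two-sided comparison of the risk with `Q`. -/
theorem maxiset_eq_and_balls {M : ℕ → Set (Model φ)} {lam : ℕ → ℝ} {ρ : ℕ → ℝ}
    {mHat : ℕ → L2 D → Ω → Model φ} (hρ : ∀ n, 1 ≤ n → 0 < ρ n) {C C' : ℝ} (hC : 0 < C)
    (hC' : 0 < C')
    (hU : ∀ s n, 1 ≤ n → risk P W mHat n s ≤ ENNReal.ofReal (C * Q M lam s n))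
    (hL : ∀ s B, 0 ≤ B → (∀ n, 1 ≤ n → risk P W mHat n s ≤ ENNReal.ofReal (B * ρ n ^ 2)) →
      ∀ n, 1 ≤ n → Q M lam s n ≤ C' * (B * ρ n ^ 2)) :
    maxiset P W mHat ρ = approxSet M lam ρ ∧
      (∀ R : ℝ, 0 < R → ∃ R' : ℝ, 0 < R' ∧ maxisetBall P W mHat ρ R ⊆ approxBall M lam ρ R') ∧
      (∀ R' : ℝ, 0 < R' → ∃ R : ℝ, 0 < R ∧
        approxBall M lam ρ R' ⊆ maxisetBall P W mHat ρ R) := by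
  have hU' : ∀ s B, 0 ≤ B → supRate ρ (fun n => ENNReal.ofReal (Q M lam s n)) ≤ ENNReal.ofReal B →
      supRate ρ (fun n => risk P W mHat n s) ≤ ENNReal.ofReal (C * B) := fun s B hB h => by
    rw [supRate_le_ofReal_iff hρ] at h ⊢
    intro n hn
    refine (hU s n hn).trans (ENNReal.ofReal_le_ofReal ?_)
    have := (ENNReal.ofReal_le_ofReal_iff (by positivity)).1 (h n hn)
    rw [mul_assoc]
    gcongr
  have hL' : ∀ s B, 0 ≤ B → supRate ρ (fun n => risk P W mHat n s) ≤ ENNReal.ofReal B →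
      supRate ρ (fun n => ENNReal.ofReal (Q M lam s n)) ≤ ENNReal.ofReal (C' * B) :=
    fun s B hB h => by
      rw [supRate_le_ofReal_iff hρ] at h ⊢
      intro n hn
      refine ENNReal.ofReal_le_ofReal ?_
      rw [mul_assoc]
      exact hL s B hB h n hn
  refine ⟨?_, fun R hR => ⟨√C' * R, by positivity, fun s hs => ?_⟩,
    fun R hR => ⟨√C * R, by positivity, fun s hs => ?_⟩⟩
  · ext s
    constructor
    · intro h
      have h' : supRate ρ (fun n => risk P W mHat n s) < ∞ := h
      exact (hL' s _ ENNReal.toReal_nonneg (ENNReal.ofReal_toReal h'.ne).ge).trans_lt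
        ENNReal.ofReal_lt_top
    · intro h
      have h' : supRate ρ (fun n => ENNReal.ofReal (Q M lam s n)) < ∞ := h
      exact (hU' s _ ENNReal.toReal_nonneg (ENNReal.ofReal_toReal h'.ne).ge).trans_lt
        ENNReal.ofReal_lt_top
  · have := hL' s (R ^ 2) (sq_nonneg R) hs
    rwa [← Real.sq_sqrt hC'.le, ← mul_pow] at this
  · have := hU' s (R ^ 2) (sq_nonneg R) hs
    rwa [← Real.sq_sqrt hC.le, ← mul_pow] at this

end Maxiset

/-! ### Bounding `Q` by the rate when the risk obeys it. -/

section LowerBound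

variable {D : Set ℝ} {ι : Type*} [Countable ι] {φ : ι → L2 D} {Ω : Type*} [MeasurableSpace Ω]
  {P : Measure Ω} [IsProbabilityMeasure P] {W : L2 D → Ω → ℝ}

theorem IsWhiteNoise.exists_Q_le_mul (hW : IsWhiteNoise W P)
    {M : ℕ → Set (Model φ)} {lam : ℕ → ℝ} {n : ℕ} (hn : 1 ≤ n) (hlam : 0 < lam n)
    {c q : ℝ} (hc : 0 ≤ c) (hq : 0 ≤ q) (hq1 : q < 1)
    (hs : Summable fun m : M n => Real.exp (-(c * (m.1.dim : ℝ) / 2)))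
    (ht : ∑' m : M n, Real.exp (-(c * (m.1.dim : ℝ) / 2)) ≤ q)
    {mHat : ℕ → L2 D → Ω → Model φ} (hm : ∀ s, ∀ᵐ ω ∂P, mHat n s ω ∈ M n) :
    ∃ C : ℝ, 0 ≤ C ∧ ∀ s y, 0 ≤ y → risk P W mHat n s ≤ ENNReal.ofReal y →
      Q M lam s n ≤ C * y := by
  have hx : 0 < Real.exp (1 + c) - 1 := by
    have := Real.add_one_le_exp (1 + c)
    linarith
  have hmin : 0 < min 1 (1 / (lam n * (Real.exp (1 + c) - 1))) :=
    lt_min one_pos (by positivity)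
  have h1q : 0 < 1 - q := by linarith
  refine ⟨1 / (min 1 (1 / (lam n * (Real.exp (1 + c) - 1))) * (1 - q)), by positivity,
    fun s y hy h => ?_⟩
  have h1 := le_div_of_ofReal_mul_le h1q hy
    ((hW.ofReal_mul_Q_le_risk hn hlam hc hq hs ht s (hm s)).trans h)
  rw [mul_comm, ← le_div_iff₀ hmin] at h1
  exact h1.trans_eq (by field_simp)

/-- The minimizer at `n` is a competitor at `2n` by nestedness, with the same bias; the risk
controls that bias, so only the penalty is carried over. -/
theorem IsWhiteNoise.Q_two_mul_le (hW : IsWhiteNoise W P)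
    {M : ℕ → Set (Model φ)} {lam : ℕ → ℝ} {n : ℕ} (hn : 1 ≤ n) (hne : (M n).Nonempty)
    (hnest : M n ⊆ M (2 * n)) (hlam : 2 ≤ lam n) (hlam2 : 0 ≤ lam (2 * n))
    (hdim : ∀ m ∈ M n, 1 ≤ m.dim)
    (hfin : ∀ d : ℝ, {m : Model φ | m ∈ M n ∧ (m.dim : ℝ) ≤ d}.Finite)
    {c q : ℝ} (hc : c ≤ lam n) (hq : 0 ≤ q) (hq1 : q < 1)
    (hs : Summable fun m : M n => Real.exp (-(c * (m.1.dim : ℝ) / 2)))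
    (ht : ∑' m : M n, Real.exp (-(c * (m.1.dim : ℝ) / 2)) ≤ q) {s : L2 D}
    {mHat : ℕ → L2 D → Ω → Model φ}
    (hm : ∀ᵐ ω ∂P, IsPenMinimizer W M lam n s ω (mHat n s ω))
    {g : ℝ} (hg : 0 < g) (hg1 : g ≤ 1) {a : ℝ} (ha : a = 1 / (4 * (1 + 64 / g)))
    {y : ℝ} (hy : 0 ≤ y) (hrisk : risk P W mHat n s ≤ ENNReal.ofReal y) :
    Q M (fun n => a * lam n) s (2 * n)
      ≤ (lam (2 * n) / (2 * lam n) + g / 4) * Q M (fun n => a * lam n) s n + 3 / (1 - q) * y := by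
  have hn' : (0 : ℝ) < n := by exact_mod_cast hn
  have ha0 : 0 < a := by rw [ha]; positivity
  have hl : 0 < lam n := by linarith
  obtain ⟨m, hmM, hQ, hmin⟩ := exists_Q_eq (lam := fun n => a * lam n) hn
    (mul_pos ha0 hl) hne hfin s
  have h1 := le_div_of_ofReal_mul_le (by linarith) hy
    ((hW.ofReal_bias_sub_le_risk hn hlam hdim hc hq hs ht s hm hg hg1 ha hmM hmin).trans hrisk)
  have h2 := Q_le (M := M) (lam := fun n => a * lam n) (mul_nonneg ha0.le hlam2) s (hnest hmM)
  have h3 : a * lam (2 * n) / (2 * n : ℕ) * m.dim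
      = lam (2 * n) / (2 * lam n) * (a * lam n / n * m.dim) := by
    push_cast
    field_simp
  rw [h3] at h2
  rw [hQ]
  have hp : 0 ≤ a * lam n / n * m.dim := by positivity
  have hb := sq_nonneg ‖m.proj s - s‖
  have ht0 : 0 ≤ lam (2 * n) / (2 * lam n) := by positivity
  set b := ‖m.proj s - s‖ ^ 2
  set p := a * lam n / n * m.dim
  set t := lam (2 * n) / (2 * lam n)
  have h4 : 3 / (1 - q) * y = 3 * (y / (1 - q)) := by ring
  rw [h4]
  have h5 : 0 ≤ t * b := by positivity
  have h6 : 0 ≤ g / 4 * b := by positivity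
  linarith

theorem IsWhiteNoise.exists_Q_le_mul_rate_sq (hW : IsWhiteNoise W P)
    {M : ℕ → Set (Model φ)} {lam : ℕ → ℝ} (hne : ∀ n, 1 ≤ n → (M n).Nonempty)
    (hnest : ∀ k n, 1 ≤ k → k ≤ n → M k ⊆ M n) (hpos : ∀ n, 1 ≤ n → 0 < lam n)
    (hmono : ∀ k n, 1 ≤ k → k ≤ n → lam k ≤ lam n) {α₀ α δ : ℝ} {n₀ : ℕ} (hn₀ : 1 ≤ n₀)
    (hα : 0 < α) (hαα : α ≤ α₀) (hδ0 : 0 < δ) (hδ : δ ≤ 1 / 2)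
    (hdouble : ∀ n, n₀ ≤ n → lam (2 * n) ≤ 2 * (1 - δ) * lam n) (hlarge : 2 ≤ lam n₀)
    {κ q : ℝ} (hκ : 1 < κ) (hq : 0 ≤ q) (hq1 : q < 1)
    (hs : ∀ n, 1 ≤ n →
      Summable fun m : M n => Real.exp (-((√(lam n / κ) - 1) ^ 2 * (m.1.dim : ℝ) / 2)))
    (ht : ∀ n, 1 ≤ n →
      ∑' m : M n, Real.exp (-((√(lam n / κ) - 1) ^ 2 * (m.1.dim : ℝ) / 2)) ≤ q)
    {mHat : ℕ → L2 D → Ω → Model φ} (hm : IsPenSelection P W M lam mHat) :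
    ∃ C : ℝ, 0 < C ∧ ∀ s B, 0 ≤ B →
      (∀ n, 1 ≤ n → risk P W mHat n s ≤ ENNReal.ofReal (B * rate lam α n ^ 2)) →
      ∀ n, 1 ≤ n → Q M lam s n ≤ C * (B * rate lam α n ^ 2) := by
  have hα₀ : 0 < α₀ := hα.trans_le hαα
  have hg := gConst_pos hα₀ hδ0 hδ
  have hg1 := gConst_le_half hα₀ hδ0 hδ
  have hbase : ∀ n, ∃ C : ℝ, 0 ≤ C ∧ (1 ≤ n → ∀ s y, 0 ≤ y →
      risk P W mHat n s ≤ ENNReal.ofReal y → Q M lam s n ≤ C * y) := fun n => by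
    by_cases hn : 1 ≤ n
    · obtain ⟨C, hC0, hC⟩ := hW.exists_Q_le_mul hn (hpos n hn) (sq_nonneg _) hq hq1 (hs n hn)
        (ht n hn) fun s => (hm n hn s).mono fun ω h => h.1
      exact ⟨C, hC0, fun _ => hC⟩
    · exact ⟨0, le_rfl, fun h => absurd h hn⟩
  choose C₁ hC₁ hCQ using hbase
  obtain ⟨a, ha⟩ : ∃ a : ℝ, a = 1 / (4 * (1 + 64 / gConst δ α₀)) := ⟨_, rfl⟩
  have ha0 : 0 < a := by rw [ha]; positivity
  have ha1 : a ≤ 1 := by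
    rw [ha, div_le_one (by positivity)]
    have : 0 < 64 / gConst δ α₀ := by positivity
    linarith
  set C₂ : ℝ := 4 * max (C₁ n₀) (2 * (3 / (1 - q)) / gConst δ α₀)
  have hC₂ : 0 ≤ C₂ := mul_nonneg (by norm_num) ((hC₁ n₀).trans (le_max_left _ _))
  have hsum : 0 ≤ ∑ n ∈ Finset.range n₀, C₁ n := Finset.sum_nonneg fun n _ => hC₁ n
  -- The sum covers `n < n₀`; dividing by `a` returns from the weakened penalty through `a Q ≤ Q_a`;
  -- the 1 only ensures positivity.
  refine ⟨C₂ / a + ∑ n ∈ Finset.range n₀, C₁ n + 1, by positivity, fun s B hB hrisk n hn => ?_⟩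
  have hy : ∀ n, 0 ≤ B * rate lam α n ^ 2 := fun n => mul_nonneg hB (sq_nonneg _)
  have hlast : ∀ C, C ≤ C₂ / a + ∑ n ∈ Finset.range n₀, C₁ n + 1 →
      Q M lam s n ≤ C * (B * rate lam α n ^ 2) → Q M lam s n
        ≤ (C₂ / a + ∑ n ∈ Finset.range n₀, C₁ n + 1) * (B * rate lam α n ^ 2) := fun C hC h =>
    h.trans (mul_le_mul_of_nonneg_right hC (hy n))
  have hdiv : 0 ≤ C₂ / a := by positivity
  rcases lt_or_ge n n₀ with hlt | hge
  · refine hlast (C₁ n) ?_ (hCQ n hn s _ (hy n) (hrisk n hn))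
    have := Finset.single_le_sum (fun i _ => hC₁ i) (Finset.mem_range.2 hlt)
    linarith
  refine hlast (C₂ / a) (by linarith) ?_
  have h := le_mul_rate_sq_of_doubling hpos hmono hn₀ hα hαα hδ0 hδ hdouble hB (hC₁ n₀)
    (q := Q M (fun n => a * lam n) s) (C₂ := 3 / (1 - q)) (fun k hk => ?_)
    (fun k j hk hkj hj => ?_)
    ((Q_const_mul_le (hpos n₀ hn₀).le (hne n₀ hn₀) ha0.le ha1 s).trans
      (hCQ n₀ hn₀ s _ (hy n₀) (hrisk n₀ hn₀))) n hge
  · have h1 := (mul_Q_le_Q_const_mul (hpos n hn).le (hne n hn) ha0.le ha1 s).trans h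
    rw [div_mul_eq_mul_div, le_div_iff₀ ha0, mul_comm]
    exact h1
  · have hk1 := hn₀.trans hk
    have hlk : 2 ≤ lam k := hlarge.trans (hmono n₀ k hn₀ hk)
    exact hW.Q_two_mul_le hk1 (hne k hk1) (hnest k _ hk1 (by omega)) hlk
      (hpos _ (by omega)).le
      (fun m hmem => one_le_dim_of_tsum_lt_one (hs k hk1) ((ht k hk1).trans_lt hq1) hmem)
      (finite_dim_le_of_summable (sq_nonneg _) (hs k hk1))
      (sqrt_div_sub_one_sq_le_self hκ (by linarith)) hq hq1 (hs k hk1) (ht k hk1) (hm k hk1 s) hg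
      (by linarith) ha (hy k) (hrisk k hk1)
  · have hk1 := hn₀.trans hk
    refine Q_le_two_mul_Q hk1 hkj (hnest k j hk1 hkj) (hne k hk1)
      (mul_nonneg ha0.le (hpos k hk1).le) (mul_nonneg ha0.le (hpos j (hk1.trans hkj)).le) ?_ s
    have h1 := hmono j (2 * k) (hk1.trans hkj) hj
    have h2 := hdouble k hk
    have h3 := mul_pos hδ0 (hpos k hk1)
    nlinarith

end LowerBound

end WhiteNoise

theorem mainTheorem2
    {D : Set ℝ} (hD : MeasurableSet D)
    {Ω : Type*} [MeasurableSpace Ω] (P : Measure Ω) [IsProbabilityMeasure P]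
    (W : WhiteNoise.L2 D → Ω → ℝ) (hW : WhiteNoise.IsWhiteNoise W P)
    {ι : Type*} [Countable ι] (φ : ι → WhiteNoise.L2 D)
    (M : ℕ → Set (WhiteNoise.Model φ))
    (hM_nonempty : ∀ n, 1 ≤ n → (M n).Nonempty)
    (hM_nested : ∀ n, 1 ≤ n → M n ⊆ M (n + 1))
    (lam : ℕ → ℝ)
    (hlam_pos : ∀ n, 1 ≤ n → 0 < lam n)
    (hlam_mono : ∀ n, 1 ≤ n → lam n ≤ lam (n + 1))
    (hlam_lim : Filter.Tendsto (fun n : ℕ => lam n / n) Filter.atTop (nhds 0))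
    (α₀ : ℝ) (hα₀ : 0 < α₀)
    (n₀ : ℕ) (hn₀ : 1 ≤ n₀)
    (δ : ℝ) (hδ_pos : 0 < δ) (hδ_le : δ ≤ 1 / 2)
    (p : ℝ) (hp_pos : 0 < p) (hp_lt : p < 1)
    (hlam_double : ∀ n, n₀ ≤ n → lam (2 * n) ≤ 2 * (1 - δ) * lam n)
    (hlam_large : WhiteNoise.Upsilon δ p α₀ ≤ lam n₀)
    (κ : ℝ) (hκ : 1 < κ)
    (hlam_init : ∀ n, 1 ≤ n → n < n₀ → κ ≤ lam n)
    (hKraft : ∀ n, 1 ≤ n →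
      Summable (fun m : M n => Real.exp (-((√(lam n / κ) - 1) ^ 2 * (m.1.dim : ℝ) / 2))) ∧
      ∑' m : M n, Real.exp (-((√(lam n / κ) - 1) ^ 2 * (m.1.dim : ℝ) / 2)) ≤ √(1 - p)) :
    (∀ n, 1 ≤ n → ∀ s : WhiteNoise.L2 D, ∀ᵐ ω ∂P,
      ∃ m, WhiteNoise.IsPenMinimizer W M lam n s ω m) ∧
    ∀ mHat : ℕ → WhiteNoise.L2 D → Ω → WhiteNoise.Model φ,
      WhiteNoise.IsPenSelection P W M lam mHat →
      ∀ α : ℝ, 0 < α → α ≤ α₀ →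
        WhiteNoise.maxiset P W mHat (WhiteNoise.rate lam α)
          = WhiteNoise.approxSet M lam (WhiteNoise.rate lam α) ∧
        (∀ R : ℝ, 0 < R → ∃ R' : ℝ, 0 < R' ∧
          WhiteNoise.maxisetBall P W mHat (WhiteNoise.rate lam α) R
            ⊆ WhiteNoise.approxBall M lam (WhiteNoise.rate lam α) R') ∧
        (∀ R' : ℝ, 0 < R' → ∃ R : ℝ, 0 < R ∧
          WhiteNoise.approxBall M lam (WhiteNoise.rate lam α) R'
            ⊆ WhiteNoise.maxisetBall P W mHat (WhiteNoise.rate lam α) R) := by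
  have hnest : ∀ k n, 1 ≤ k → k ≤ n → M k ⊆ M n := fun k n hk hkn => by
    induction n, hkn using Nat.le_induction with
    | base => exact subset_rfl
    | succ n hn ih => exact ih.trans (hM_nested n (hk.trans hn))
  have hmono : ∀ k n, 1 ≤ k → k ≤ n → lam k ≤ lam n := fun k n hk hkn => by
    induction n, hkn using Nat.le_induction with
    | base => exact le_rfl
    | succ n hn ih => exact ih.trans (hlam_mono n (hk.trans hn))
  -- The fixed weight `a` already depends on `g`, so this numerical lower bound is all that the
  -- doubling argument and the slack estimates require of the size of `lam n₀`.
  have hlarge : 8 ≤ lam n₀ :=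
    (WhiteNoise.le_Upsilon hα₀ hδ_pos hδ_le hp_pos hp_lt).trans hlam_large
  have hor : ∀ n, 1 ≤ n → 8 ≤ lam n ∨ κ ≤ lam n := fun n hn => by
    rcases lt_or_ge n n₀ with h | h
    · exact Or.inr (hlam_init n hn h)
    · exact Or.inl (hlarge.trans (hmono n₀ n hn₀ h))
  have hq1 : √(1 - p) < 1 := by
    rw [Real.sqrt_lt' one_pos]
    linarith
  -- `k = min (√κ) 2` splits the slack: `k > 1` pays for the noise of the selected model, while `lam
  -- n / k ≥ k` keeps the noise threshold away from 1 uniformly in `n`.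
  have hk1 : 1 < min (√κ) 2 := lt_min (Real.lt_sqrt_of_sq_lt (by linarith)) one_lt_two
  have hfin := fun n hn => WhiteNoise.finite_dim_le_of_summable (sq_nonneg _) (hKraft n hn).1
  refine ⟨fun n hn s => ?_, fun mHat hmHat α hα hαα => ?_⟩
  · have hv := WhiteNoise.min_sqrt_two_le_div hκ (hor n hn)
    rw [le_div_iff₀ (by linarith)] at hv
    exact hW.ae_exists_isPenMinimizer hn (hM_nonempty n hn) (hfin n hn) hk1 (by nlinarith)
      (WhiteNoise.sqrt_div_sub_one_sq_le hκ (hor n hn)) (hKraft n hn).1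
      ((hKraft n hn).2.trans hq1.le) s
  · obtain ⟨C', hC', hL⟩ := hW.exists_Q_le_mul_rate_sq hM_nonempty hnest hlam_pos hmono hn₀ hα hαα
      hδ_pos hδ_le hlam_double (by linarith) hκ (Real.sqrt_nonneg _) hq1
      (fun n hn => (hKraft n hn).1) (fun n hn => (hKraft n hn).2) hmHat
    refine WhiteNoise.maxiset_eq_and_balls (fun n hn => WhiteNoise.rate_pos hn (hlam_pos n hn) α)
      ?_ hC' (fun s n hn => hW.risk_le hn (hM_nonempty n hn)
        (fun m hm => WhiteNoise.one_le_dim_of_tsum_lt_one (hKraft n hn).1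
          ((hKraft n hn).2.trans_lt hq1) hm) (hfin n hn) hk1 hk1
        (WhiteNoise.min_sqrt_two_le_div hκ (hor n hn))
        (WhiteNoise.sqrt_div_sub_one_sq_le hκ (hor n hn)) (hKraft n hn).1
        ((hKraft n hn).2.trans hq1.le) s (hmHat n hn s)) hL
    have h1 : 0 < 1 - 1 / min (√κ) 2 := by
      rw [sub_pos, div_lt_one (by linarith)]
      exact hk1
    positivity
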